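/- Let $R$ be a one-dimensional integral domain (that is, of Krull dimension exactly $1$) with field of fractions $K$. For a subset $S\subseteq K$ put $(R:S)=\{x\in K \mid xS\subseteq R\}$. A nonzero ideal $I$ of $R$ is called stable if it is projective as a module over its endomorphism ring $\operatorname{End}_R(I)$, and $R$ is called stable if every nonzero ideal of $R$ is stable. An ideal $I$ of $R$ is called divisorial if $I\neq 0$ and $I=(R:(R:I))$, and $R$ is called a Mori domain if it satisfies the ascending chain condition on divisorial ideals. If $R$ is stable, then $R$ is $2$-$v$-generated, that is, every nonzero ideal $I$ of $R$ contains elements $a,b$ such that $(R:I)=(R:\{a,b\})$. Moreover, $R$ is a Mori domain. (In particular, both conclusions hold when $R$ is local, that is, has a unique maximal ideal; no Noetherian hypothesis is made.) -/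

import Mathlib

/-- The `R`-submodule `(R : S) = {x ∈ K | x S ⊆ R}` of `K`, for a subset `S` of `K`;
here `K` is meant to be the field of fractions of the domain `R`. -/
def fieldColon (R : Type*) {K : Type*} [CommRing R] [Field K] [Algebra R K] (S : Set K) :
    Submodule R K where
  carrier := {x | ∀ s ∈ S, x * s ∈ Set.range (algebraMap R K)}
  zero_mem' := fun s _ => ⟨0, by simp⟩
  add_mem' := by
    intro x y hx hy s hs
    obtain ⟨u, hu⟩ := hx s hs
    obtain ⟨v, hv⟩ := hy s hs
    exact ⟨u + v, by rw [map_add, hu, hv, add_mul]⟩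
  smul_mem' := by
    intro c x hx s hs
    obtain ⟨u, hu⟩ := hx s hs
    exact ⟨c * u, by rw [map_mul, hu, Algebra.smul_def, mul_assoc]⟩

/-- The image in `K` of a subset of `R`. -/
def imageIn {R : Type*} (K : Type*) [CommRing R] [Field K] [Algebra R K] (S : Set R) : Set K :=
  algebraMap R K '' S

/-- An ideal `I` is stable if it is projective as a module over its endomorphism ring
`End_R(I)`, which acts on `I` by evaluation. -/
def Ideal.IsStable {R : Type*} [CommRing R] (I : Ideal R) : Prop :=
  Module.Projective (Module.End R I) I

/-- A domain is stable if each of its nonzero ideals is stable. -/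
def IsStableDomain (R : Type*) [CommRing R] : Prop :=
  IsDomain R ∧ ∀ I : Ideal R, I ≠ ⊥ → I.IsStable

/-- An ideal `I` is divisorial if `I ≠ 0` and `I = (R : (R : I))`, as subsets of `K`. -/
def Ideal.IsDivisorial {R : Type*} (K : Type*) [CommRing R] [Field K] [Algebra R K]
    (I : Ideal R) : Prop :=
  I ≠ ⊥ ∧
    imageIn K (I : Set R) = (fieldColon R (fieldColon R (imageIn K (I : Set R)) : Set K) : Set K)

/-- A Mori domain is a domain satisfying the ascending chain condition on divisorial ideals. -/
def IsMoriDomain (R K : Type*) [CommRing R] [Field K] [Algebra R K] : Prop :=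
  IsDomain R ∧ ∀ f : ℕ → Ideal R, Monotone f → (∀ n, (f n).IsDivisorial K) →
    ∃ N, ∀ n, N ≤ n → f n = f N

/-- An ideal `I` is `2`-`v`-generated if it contains `a, b` with `(R : I) = (R : {a, b})`. -/
def Ideal.IsTwoVGenerated {R : Type*} (K : Type*) [CommRing R] [Field K] [Algebra R K]
    (I : Ideal R) : Prop :=
  ∃ a ∈ I, ∃ b ∈ I,
    fieldColon R (imageIn K (I : Set R)) = fieldColon R (imageIn K ({a, b} : Set R))

/-- A domain is `2`-`v`-generated if each of its nonzero ideals is `2`-`v`-generated. -/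
def IsTwoVGeneratedDomain (R K : Type*) [CommRing R] [Field K] [Algebra R K] : Prop :=
  IsDomain R ∧ ∀ I : Ideal R, I ≠ ⊥ → I.IsTwoVGenerated K

/-! Stability of a fractional ideal `J` is used in the form `1 ∈ J (J : J²)`, which a dual basis
extracts from projectivity and which passes to localizations.

Local case. Let `B` be the integral closure of `R` in `K`. A stable module that contains `1` and
lies in `B` is a ring, so integral elements are quadratic over `R`; moreover one of `t`, `1/t`,
`1/(1+t)` is always integral. In dimension one this yields, for each nonzero ideal `I`, some `x ∈ I`
with `I ⊆ xB`. Put `L = x⁻¹I`, so that `1 ∈ L ⊆ B`. It is enough to find `v₀ ∈ L` such that every `r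
∈ R` with `r v₀ ∈ R` satisfies `r L ⊆ R`: then `x` and `x v₀` do the job. If `B` is not local, then
`B = R + Rz` and `L = R + Az` for an ideal `A`, and `v₀ = az` works when `A ⊆ aB`. If `B` is local,
it is a valuation ring, and the absence of `v₀` would force a nonzero element of `R` to be divisible
by too high a power of a fixed nonunit.

Global case. A nonzero element lies in finitely many maximal ideals. Local pairs are glued by the
Chinese remainder theorem, since a small enough perturbation of a local pair still works by a
determinant argument.

Mori property. The two elements chosen for the union of a chain of divisorial ideals already lie in
one term, which must then be the union. -/

open scoped nonZeroDivisors

/-- An `R`-submodule `J` of `K` is stable if `1 ∈ J (J : J²)`; for a fractional ideal this says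
that `J` is invertible over `(J : J)`. -/
def Submodule.IsStable {R K : Type*} [CommRing R] [Field K] [Algebra R K]
    (J : Submodule R K) : Prop :=
  (1 : K) ∈ J * (J / (J * J))

/-- All nonzero fractional ideals of `R` are stable. -/
def HasStableFractionalIdeals (R K : Type*) [CommRing R] [Field K] [Algebra R K] : Prop :=
  ∀ J : Submodule R K, J ≠ ⊥ → IsFractional R⁰ J → J.IsStable

/-! ### Stable modules and integral elements -/

section Stability

variable {R K : Type*} [CommRing R] [Field K] [Algebra R K]

theorem Submodule.mem_div_mul_self {J : Submodule R K} {x : K} :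
    x ∈ J / (J * J) ↔ ∀ a ∈ J, ∀ b ∈ J, x * (a * b) ∈ J := by
  rw [Submodule.mem_div_iff_forall_mul_mem]
  refine ⟨fun h a ha b hb => h _ (Submodule.mul_mem_mul ha hb), fun h y hy => ?_⟩
  induction hy using Submodule.mul_induction_on' with
  | mem_mul_mem a ha b hb => exact h a ha b hb
  | add a _ b _ iha ihb => rw [mul_add]; exact J.add_mem iha ihb

theorem isIntegral_of_sq_eq {x : K} {a b : R}
    (h : x * x = algebraMap R K a + algebraMap R K b * x) : IsIntegral R x := by
  refine ⟨Polynomial.X ^ 2 - (Polynomial.C b * Polynomial.X + Polynomial.C a), ?_, ?_⟩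
  · exact Polynomial.monic_X_pow_sub (n := 2)
      (p := Polynomial.C b * Polynomial.X + Polynomial.C a)
      (by exact_mod_cast Polynomial.degree_linear_lt)
  · simp only [Polynomial.eval₂_sub, Polynomial.eval₂_pow, Polynomial.eval₂_X,
      Polynomial.eval₂_add, Polynomial.eval₂_mul, Polynomial.eval₂_C]
    linear_combination h

theorem isIntegral_of_isUnit_leadingCoeff {x : K} {a b c : R} (hc : IsUnit c)
    (h : algebraMap R K c * (x * x) + algebraMap R K b * x + algebraMap R K a = 0) :
    IsIntegral R x := by
  obtain ⟨d, hd⟩ := hc.exists_right_inv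
  have hd' : algebraMap R K c * algebraMap R K d = 1 := by rw [← map_mul, hd, map_one]
  refine isIntegral_of_sq_eq (a := -(d * a)) (b := -(d * b)) ?_
  simp only [map_neg, map_mul]
  linear_combination algebraMap R K d * h - (x * x) * hd'

theorem isIntegral_inv_of_isUnit_constCoeff {x : K} {a b c : R} (ha : IsUnit a)
    (h : algebraMap R K c * (x * x) + algebraMap R K b * x + algebraMap R K a = 0) :
    x ≠ 0 ∧ IsIntegral R x⁻¹ := by
  have hx : x ≠ 0 := by
    rintro rfl
    have h0 : algebraMap R K a = 0 := by simpa using h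
    exact (ha.map (algebraMap R K)).ne_zero h0
  refine ⟨hx, isIntegral_of_isUnit_leadingCoeff (a := c) (b := b) ha ?_⟩
  field_simp
  linear_combination h

theorem isIntegral_of_mem_span {s : Set K} (hs : ∀ x ∈ s, IsIntegral R x) {x : K}
    (hx : x ∈ Submodule.span R s) : IsIntegral R x := by
  have : Submodule.span R s ≤ Subalgebra.toSubmodule (integralClosure R K) :=
    Submodule.span_le.2 hs
  exact this hx

/-- A stable submodule which contains `1` and consists of integral elements is a ring. -/
theorem Submodule.IsStable.mul_mem {J : Submodule R K} (hJ : J.IsStable) (h1 : (1 : K) ∈ J)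
    (hint : ∀ x ∈ J, IsIntegral R x) {a b : K} (ha : a ∈ J) (hb : b ∈ J) : a * b ∈ J := by
  set N := J / (J * J) with hN
  have hNJ : ∀ n ∈ N, ∀ x ∈ J, ∀ y ∈ J, n * (x * y) ∈ J := fun n hn =>
    Submodule.mem_div_mul_self.1 hn
  -- As `1 ∈ J`, `N` is an ideal of the ring `E = (J : J)`. If it were proper, a maximal ideal `Q`
  -- of the integral closure of `E` would contain `N`; since `J` is integral, `J N ⊆ Q`, against `1
  -- ∈ J N`.
  suffices h : (1 : K) ∈ N by simpa using hNJ 1 h a ha b hb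
  let E : Subalgebra R K :=
    { carrier := {x | ∀ y ∈ J, x * y ∈ J}
      mul_mem' := fun {x y} hx hy z hz => by rw [mul_assoc]; exact hx _ (hy z hz)
      add_mem' := fun {x y} hx hy z hz => by rw [add_mul]; exact J.add_mem (hx z hz) (hy z hz)
      algebraMap_mem' := fun r z hz => by
        rw [← Algebra.smul_def]; exact J.smul_mem r hz }
  have hNE : ∀ n ∈ N, n ∈ E := fun n hn y hy => by simpa using hNJ n hn y hy 1 h1
  have hmul : ∀ e ∈ E, ∀ n ∈ N, e * n ∈ N := fun e he n hn => by
    rw [hN, Submodule.mem_div_mul_self]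
    intro x hx y hy
    rw [mul_assoc]
    exact he _ (hNJ n hn x hx y hy)
  let P : Ideal E :=
    { carrier := {x | (x : K) ∈ N}
      zero_mem' := N.zero_mem
      add_mem' := fun {x y} hx hy => N.add_mem hx hy
      smul_mem' := fun e x hx => hmul e e.2 x hx }
  by_contra hcon
  have hP : P ≠ ⊤ := fun h => hcon (by
    have : (1 : E) ∈ P := h ▸ Submodule.mem_top
    exact this)
  obtain ⟨m, hm, hPm⟩ := Ideal.exists_le_maximal P hP
  obtain ⟨Q, hQ, hQm⟩ := Ideal.exists_ideal_over_maximal_of_isIntegral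
    (S := integralClosure E K) m (by
      intro x hx
      have h0 : (x : K) = 0 := congrArg Subtype.val (RingHom.mem_ker.1 hx)
      rw [show x = 0 from Subtype.ext h0]
      exact m.zero_mem)
  have key : ∀ w ∈ J * N, ∃ q ∈ Q, (q : K) = w := by
    intro w hw
    induction hw using Submodule.mul_induction_on' with
    | mem_mul_mem x hx n hn =>
      have hx' : IsIntegral E x := (hint x hx).tower_top
      refine ⟨⟨x, hx'⟩ * algebraMap E (integralClosure E K) ⟨n, hNE n hn⟩,
        Q.mul_mem_left _ ?_, rfl⟩
      rw [← Ideal.mem_comap, hQm]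
      exact hPm hn
    | add x _ y _ ihx ihy =>
      obtain ⟨p, hp, rfl⟩ := ihx
      obtain ⟨q, hq, rfl⟩ := ihy
      exact ⟨p + q, Q.add_mem hp hq, rfl⟩
  obtain ⟨q, hq, hq1⟩ := key 1 hJ
  have : q = 1 := Subtype.ext hq1
  exact hQ.ne_top ((Ideal.eq_top_iff_one _).2 (this ▸ hq))

end Stability

theorem Ideal.mem_map_linearMap {R K : Type*} [CommRing R] [Field K] [Algebra R K]
    {I : Ideal R} {y : K} :
    y ∈ Submodule.map (Algebra.linearMap R K) I ↔ ∃ i ∈ I, algebraMap R K i = y :=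
  Submodule.mem_map

/-! ### Quadratic equations over a stable domain -/

section LocalQuadratic

variable {R K : Type*} [CommRing R] [Field K] [Algebra R K] [IsFractionRing R K]

theorem HasStableFractionalIdeals.isStable_of_fg (hst : HasStableFractionalIdeals R K)
    {J : Submodule R K} (hJ : J ≠ ⊥) (hfg : J.FG) : J.IsStable :=
  hst J hJ (FractionalIdeal.isFractional_of_fg hfg)

theorem HasStableFractionalIdeals.map_linearMap (hst : HasStableFractionalIdeals R K)
    {I : Ideal R} (hI : I ≠ ⊥) : (Submodule.map (Algebra.linearMap R K) I).IsStable := by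
  refine hst _ (fun h => hI ((Submodule.eq_bot_iff _).2 fun i hi => ?_)) ⟨1, one_mem R⁰, ?_⟩
  · have hi' : algebraMap R K i ∈ Submodule.map (Algebra.linearMap R K) I :=
      Ideal.mem_map_linearMap.2 ⟨i, hi, rfl⟩
    rw [h, Submodule.mem_bot] at hi'
    exact IsFractionRing.injective R K (hi'.trans (map_zero _).symm)
  · intro y hy
    obtain ⟨i, -, rfl⟩ := Ideal.mem_map_linearMap.1 hy
    exact ⟨i, by simp⟩

theorem HasStableFractionalIdeals.mul_mem_span (hst : HasStableFractionalIdeals R K)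
    {s : Set K} (hfin : s.Finite) (h1 : (1 : K) ∈ s) (hs : ∀ x ∈ s, IsIntegral R x) {a b : K}
    (ha : a ∈ Submodule.span R s) (hb : b ∈ Submodule.span R s) :
    a * b ∈ Submodule.span R s := by
  have h1' : (1 : K) ∈ Submodule.span R s := Submodule.subset_span h1
  refine (hst.isStable_of_fg ?_ (Submodule.fg_span hfin)).mul_mem h1'
    (fun x hx => isIntegral_of_mem_span hs hx) ha hb
  intro h
  rw [h, Submodule.mem_bot] at h1'
  exact one_ne_zero h1'

theorem HasStableFractionalIdeals.exists_sq_eq (hst : HasStableFractionalIdeals R K) {x : K}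
    (hx : IsIntegral R x) : ∃ a b : R, x * x = algebraMap R K a + algebraMap R K b * x := by
  have hmem : x ∈ Submodule.span R ({1, x} : Set K) := Submodule.subset_span (by simp)
  have := hst.mul_mem_span (s := {1, x}) (by simp) (by simp)
    (by rintro y (rfl | rfl); exacts [isIntegral_one, hx]) hmem hmem
  obtain ⟨a, b, h⟩ := Submodule.mem_span_pair.1 this
  exact ⟨a, b, by rw [← h]; simp [Algebra.smul_def]⟩

theorem HasStableFractionalIdeals.exists_mul_eq (hst : HasStableFractionalIdeals R K) {x y : K}
    (hx : IsIntegral R x) (hy : IsIntegral R y) : ∃ a b c : R,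
      x * y = algebraMap R K a + algebraMap R K b * x + algebraMap R K c * y := by
  have hmx : x ∈ Submodule.span R ({1, x, y} : Set K) := Submodule.subset_span (by simp)
  have hmy : y ∈ Submodule.span R ({1, x, y} : Set K) := Submodule.subset_span (by simp)
  have := hst.mul_mem_span (s := {1, x, y}) (by simp) (by simp)
    (by rintro z (rfl | rfl | rfl); exacts [isIntegral_one, hx, hy]) hmx hmy
  obtain ⟨a, b, c, h⟩ := Submodule.mem_span_triple.1 this
  exact ⟨a, b, c, by rw [← h]; simp [Algebra.smul_def]⟩

/-- The elements of `R` multiplying an integral element `v` into `R` form an ideal which is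
closed under multiplication by integral elements, as long as the product stays in `R`. -/
theorem HasStableFractionalIdeals.mul_mul_mem (hst : HasStableFractionalIdeals R K) {r v z : K}
    (hv : IsIntegral R v) (hz : IsIntegral R z) (hr : r ∈ Set.range (algebraMap R K))
    (hrv : r * v ∈ Set.range (algebraMap R K)) (hrz : r * z ∈ Set.range (algebraMap R K)) :
    r * z * v ∈ Set.range (algebraMap R K) := by
  obtain ⟨a, b, c, h⟩ := hst.exists_mul_eq hz hv
  obtain ⟨r, rfl⟩ := hr
  obtain ⟨p, hp⟩ := hrv
  obtain ⟨q, hq⟩ := hrz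
  refine ⟨r * a + b * q + c * p, ?_⟩
  simp only [map_add, map_mul, hp, hq]
  linear_combination -algebraMap R K r * h

variable [IsLocalRing R]

/-- If `R` is local, then of `t`, `1 / t` and `1 / (1 + t)` at least one is integral. -/
theorem HasStableFractionalIdeals.isIntegral_or_inv (hst : HasStableFractionalIdeals R K)
    (t : K) : IsIntegral R t ∨ (t ≠ 0 ∧ IsIntegral R t⁻¹) ∨
      (1 + t ≠ 0 ∧ IsIntegral R (1 + t)⁻¹) := by
  -- One quadratic relation with a unit coefficient suffices. If only the middle coefficient is a
  -- unit, rewriting the relation in `1 + t` gives the constant term `α - β + γ`, a unit.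
  have rel : ∀ α β γ : R, (IsUnit α ∨ IsUnit β ∨ IsUnit γ) →
      algebraMap R K α * (t * t) + algebraMap R K β * t + algebraMap R K γ = 0 →
      IsIntegral R t ∨ (t ≠ 0 ∧ IsIntegral R t⁻¹) ∨ (1 + t ≠ 0 ∧ IsIntegral R (1 + t)⁻¹) := by
    intro α β γ hu h
    by_cases hα : IsUnit α
    · exact Or.inl (isIntegral_of_isUnit_leadingCoeff hα h)
    by_cases hγ : IsUnit γ
    · exact Or.inr (Or.inl (isIntegral_inv_of_isUnit_constCoeff hγ h))
    have hβ : IsUnit β := by tauto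
    right; right
    refine isIntegral_inv_of_isUnit_constCoeff (c := α) (b := β - 2 * α) (a := α - β + γ) ?_ ?_
    · by_contra hn
      have h1 : α - β + γ ∈ IsLocalRing.maximalIdeal R := hn
      have h2 : α ∈ IsLocalRing.maximalIdeal R := hα
      have h3 : γ ∈ IsLocalRing.maximalIdeal R := hγ
      have : β ∈ IsLocalRing.maximalIdeal R := by
        have := Ideal.sub_mem _ (Ideal.add_mem _ h2 h3) h1
        convert this using 1; ring
      exact this hβ
    · simp only [map_sub, map_add, map_mul, map_ofNat]
      linear_combination h
  set J : Submodule R K := Submodule.span R {1, t} with hJ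
  have h1 : (1 : K) ∈ J := Submodule.subset_span (by simp)
  have ht : t ∈ J := Submodule.subset_span (by simp)
  have hst' : (1 : K) ∈ J * (J / (J * J)) := by
    refine hst.isStable_of_fg ?_ (Submodule.fg_span (by simp))
    intro h
    rw [h, Submodule.mem_bot] at h1
    exact one_ne_zero h1
  obtain ⟨x₀, hx₀, x₁, hx₁, hsum⟩ : ∃ x₀ ∈ J / (J * J), ∃ x₁ ∈ J / (J * J), x₀ + t * x₁ = 1 := by
    generalize hN : J / (J * J) = N at hst' ⊢
    rw [hJ, Submodule.span_insert, Submodule.sup_mul] at hst'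
    obtain ⟨u, hu, w, hw, huw⟩ := Submodule.mem_sup.1 hst'
    obtain ⟨x₀, hx₀, rfl⟩ := Submodule.mem_span_singleton_mul.1 hu
    obtain ⟨x₁, hx₁, rfl⟩ := Submodule.mem_span_singleton_mul.1 hw
    exact ⟨x₀, hx₀, x₁, hx₁, by simpa using huw⟩
  rw [Submodule.mem_div_mul_self] at hx₀ hx₁
  have coord : ∀ x ∈ J, ∃ a b : R, x = algebraMap R K a + algebraMap R K b * t := by
    intro x hx
    obtain ⟨a, b, h⟩ := Submodule.mem_span_pair.1 hx
    exact ⟨a, b, by rw [← h]; simp [Algebra.smul_def]⟩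
  obtain ⟨p, q, e1⟩ := coord _ (hx₀ 1 h1 1 h1)
  obtain ⟨m, n, e2⟩ := coord _ (hx₀ 1 h1 t ht)
  obtain ⟨e', f', e3⟩ := coord _ (hx₀ t ht t ht)
  obtain ⟨p', q', e4⟩ := coord _ (hx₁ 1 h1 1 h1)
  obtain ⟨c, d, e5⟩ := coord _ (hx₁ 1 h1 t ht)
  obtain ⟨e, f, e6⟩ := coord _ (hx₁ t ht t ht)
  simp only [mul_one, one_mul] at e1 e2 e3 e4 e5 e6
  -- Multiplying `x₀ + t x₁ = 1` by `1`, `t` or `t²` and expanding in different ways gives five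
  -- relations. The five tested coefficients have a signed sum equal to `-1`, so one of them is a
  -- unit.
  by_cases u1 : IsUnit (f - 1)
  · refine rel (f - 1) (f' + e) e' (Or.inl u1) ?_
    simp only [map_sub, map_add, map_one]
    linear_combination -e3 - t * e6 + t * t * hsum
  by_cases u2 : IsUnit (n + f - 1)
  · refine rel 0 (n + f - 1) (m + e) (Or.inr (Or.inl u2)) ?_
    simp only [map_sub, map_add, map_one, map_zero]
    linear_combination -e2 - e6 + t * hsum
  by_cases u3 : IsUnit (n + c - 1)
  · refine rel d (n + c - 1) m (Or.inr (Or.inl u3)) ?_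
    simp only [map_sub, map_add, map_one]
    linear_combination -e2 - t * e5 + t * hsum
  by_cases u4 : IsUnit (p + c - 1)
  · refine rel 0 (q + d) (p + c - 1) (Or.inr (Or.inr u4)) ?_
    simp only [map_sub, map_add, map_one, map_zero]
    linear_combination -e1 - e5 + hsum
  by_cases u5 : IsUnit (p - 1)
  · refine rel q' (q + p') (p - 1) (Or.inr (Or.inr u5)) ?_
    simp only [map_sub, map_add, map_one]
    linear_combination -e1 - t * e4 + hsum
  exfalso
  have mem : ∀ x : R, ¬ IsUnit x → x ∈ IsLocalRing.maximalIdeal R := fun x hx => hx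
  have := Ideal.sub_mem _ (Ideal.add_mem _ (Ideal.sub_mem _ (Ideal.add_mem _
    (mem _ u1) (mem _ u3)) (mem _ u2)) (mem _ u5)) (mem _ u4)
  refine this ?_
  have e : f - 1 + (n + c - 1) - (n + f - 1) + (p - 1) - (p + c - 1) = -1 := by ring
  rw [e]
  exact isUnit_one.neg

end LocalQuadratic

/-- The element `x` of `K` is nonzero with inverse integral over `R`. -/
def HasIntegralInverse (R : Type*) {K : Type*} [CommRing R] [Field K] [Algebra R K] (x : K) :
    Prop :=
  x ≠ 0 ∧ IsIntegral R x⁻¹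

/-! ### Units of the integral closure -/

section IntegralInverse

variable {R K : Type*} [CommRing R] [Field K] [Algebra R K]

theorem HasIntegralInverse.of_mul_eq_one {x y : K} (h : x * y = 1) (hy : IsIntegral R y) :
    HasIntegralInverse R x :=
  ⟨left_ne_zero_of_mul_eq_one h, by rwa [inv_eq_of_mul_eq_one_right h]⟩

theorem HasIntegralInverse.of_mul {x y : K} (hy : IsIntegral R y)
    (h : HasIntegralInverse R (x * y)) : HasIntegralInverse R x :=
  .of_mul_eq_one (y := y * (x * y)⁻¹) (by rw [← mul_assoc]; exact mul_inv_cancel₀ h.1)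
    (hy.mul h.2)

theorem IsUnit.hasIntegralInverse {u : R} (hu : IsUnit u) :
    HasIntegralInverse R (algebraMap R K u) := by
  obtain ⟨v, hv⟩ := hu.exists_right_inv
  exact .of_mul_eq_one (y := algebraMap R K v) (by rw [← map_mul, hv, map_one])
    isIntegral_algebraMap

end IntegralInverse

section IntegralInverseLocal

variable {R K : Type*} [CommRing R] [Field K] [Algebra R K] [IsLocalRing R]

open IsLocalRing

/-- The constant term of a quadratic equation of an integral element without integral inverse
lies in the maximal ideal. -/
theorem mem_maximalIdeal_of_sq_eq {x : K} (hx : IsIntegral R x) (hu : ¬ HasIntegralInverse R x)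
    {a b : R} (h : x * x = algebraMap R K a + algebraMap R K b * x) : a ∈ maximalIdeal R := by
  by_contra ha
  have ha' : IsUnit a := by simpa using ha
  refine hu (HasIntegralInverse.of_mul (y := x - algebraMap R K b)
    (hx.sub isIntegral_algebraMap) ?_)
  convert ha'.hasIntegralInverse (K := K) using 1
  linear_combination h

theorem mem_maximalIdeal_of_mul_eq {z v : K} (hv : IsIntegral R v)
    (hu : ¬ HasIntegralInverse R z) {a : R} (h : z * v = algebraMap R K a) :
    a ∈ maximalIdeal R := by
  by_contra ha
  have ha' : IsUnit a := by simpa using ha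
  exact hu (HasIntegralInverse.of_mul hv (h ▸ ha'.hasIntegralInverse))

/-- The equations of `z` and `1 - z` have constant terms `a` and `b + a - 1`, both in the maximal
ideal. So `z` is idempotent modulo the maximal ideal. -/
theorem sub_one_mem_maximalIdeal_of_sq_eq {z : K} (hz : IsIntegral R z)
    (hz0 : ¬ HasIntegralInverse R z) (hz1 : ¬ HasIntegralInverse R (1 - z)) {a b : R}
    (h : z * z = algebraMap R K a + algebraMap R K b * z) : b - 1 ∈ maximalIdeal R := by
  have h1 : (1 - z) * (1 - z) =
      algebraMap R K (b + a - 1) + algebraMap R K (2 - b) * (1 - z) := by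
    simp only [map_sub, map_add, map_one, map_ofNat]
    linear_combination h
  have := Ideal.sub_mem _ (mem_maximalIdeal_of_sq_eq (isIntegral_one.sub hz) hz1 h1)
    (mem_maximalIdeal_of_sq_eq hz hz0 h)
  convert this using 1; ring

end IntegralInverseLocal

/-! ### Integral closure of a local stable domain -/

section Local

variable {R K : Type*} [CommRing R] [Field K] [Algebra R K] [IsFractionRing R K] [IsLocalRing R]

open IsLocalRing

/-- With `x² = a + bx`, the conjugate of `x` is `b - x`, and the norm `(1 + mx)(1 + m(b - x)) = 1 +
mb - m²a` is a unit of `R`. Thus the maximal ideal lies in the Jacobson radical of the integral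
closure. -/
theorem HasStableFractionalIdeals.hasIntegralInverse_one_add
    (hst : HasStableFractionalIdeals R K) {m : R} (hm : m ∈ maximalIdeal R) {x : K}
    (hx : IsIntegral R x) : HasIntegralInverse R (1 + algebraMap R K m * x) := by
  obtain ⟨a, b, h⟩ := hst.exists_sq_eq hx
  have hu : IsUnit (1 + m * b - m ^ 2 * a) := by
    have : 1 + m * b - m ^ 2 * a = 1 - m * (m * a - b) := by ring
    rw [this]
    exact (isUnit_or_isUnit_one_sub_self _).resolve_left
      fun h => (Ideal.mul_mem_right _ _ hm : m * (m * a - b) ∈ maximalIdeal R) h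
  have h2 : HasIntegralInverse R
      ((1 + algebraMap R K m * x) * (1 + algebraMap R K m * (algebraMap R K b - x))) := by
    convert hu.hasIntegralInverse (K := K) using 1
    simp only [map_sub, map_add, map_mul, map_one, map_pow]
    linear_combination -(algebraMap R K m) ^ 2 * h
  exact h2.of_mul (isIntegral_one.add
    (isIntegral_algebraMap.mul (isIntegral_algebraMap.sub hx)))

theorem HasStableFractionalIdeals.mul_ne_one (hst : HasStableFractionalIdeals R K) {m : R}
    (hm : m ∈ maximalIdeal R) {x : K} (hx : IsIntegral R x) : algebraMap R K m * x ≠ 1 := by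
  intro h
  have := (hst.hasIntegralInverse_one_add (neg_mem hm) hx).1
  exact this (by rw [map_neg]; linear_combination -h)

theorem HasStableFractionalIdeals.hasIntegralInverse_of_add
    (hst : HasStableFractionalIdeals R K) {m : R} (hm : m ∈ maximalIdeal R) {x y : K}
    (h : HasIntegralInverse R y) (hxy : y = x + algebraMap R K m) :
    HasIntegralInverse R x := by
  have h1 := hst.hasIntegralInverse_one_add (neg_mem hm) h.2
  have hy := h.1
  refine HasIntegralInverse.of_mul (y := y⁻¹) h.2 ?_
  convert h1 using 1
  rw [map_neg]
  field_simp
  rw [hxy]; ring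

/-- Stability of `J = R(z + v) + R(1 - z)` inside the ring `C = R + Rv + Rz` gives the result:
Nakayama shows `C ⊆ J²`, hence `J (J : J²) ⊆ J` and `1 ∈ J`. Writing `1` in the two generators,
either the coefficient of `z + v` is a unit and `v` can be solved for, or `1 - z` is invertible over
the integral closure. -/
theorem HasStableFractionalIdeals.exists_eq_add_mul_of_mul_eq
    (hst : HasStableFractionalIdeals R K) {z v : K}
    (hz : IsIntegral R z) (hv : IsIntegral R v) (hz0 : ¬ HasIntegralInverse R z)
    (hz1 : ¬ HasIntegralInverse R (1 - z)) {a : R} (hzv : z * v = algebraMap R K a) :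
    ∃ p q : R, v = algebraMap R K p + algebraMap R K q * z := by
  obtain ⟨μ, l, hsq⟩ := hst.exists_sq_eq hz
  have hμ : μ ∈ maximalIdeal R := mem_maximalIdeal_of_sq_eq hz hz0 hsq
  have hl : l - 1 ∈ maximalIdeal R := sub_one_mem_maximalIdeal_of_sq_eq hz hz0 hz1 hsq
  have ha : a ∈ maximalIdeal R := mem_maximalIdeal_of_mul_eq hv hz0 hzv
  obtain ⟨e, f, hvsq⟩ := hst.exists_sq_eq hv
  have he : e ∈ maximalIdeal R := by
    refine mem_maximalIdeal_of_sq_eq hv (fun hvu => hz1 ?_) hvsq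
    convert hst.hasIntegralInverse_one_add (neg_mem ha) hvu.2 using 1
    have hv0 := hvu.1
    rw [map_neg]
    field_simp
    rw [← hzv]; ring
  set C : Submodule R K := Submodule.span R {1, v, z} with hC
  set J : Submodule R K := Submodule.span R {z + v, 1 - z} with hJ
  have h1C : (1 : K) ∈ C := Submodule.subset_span (by simp)
  have hvC : v ∈ C := Submodule.subset_span (by simp)
  have hzC : z ∈ C := Submodule.subset_span (by simp)
  have hx : z + v ∈ J := Submodule.subset_span (by simp)
  have hy : 1 - z ∈ J := Submodule.subset_span (by simp)
  have hJC : J ≤ C := by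
    rw [hJ, Submodule.span_le]
    rintro w (rfl | rfl)
    exacts [C.add_mem hzC hvC, C.sub_mem h1C hzC]
  have hmulC : ∀ x ∈ C, ∀ y ∈ C, x * y ∈ C := fun x hx y hy =>
    hst.mul_mem_span (s := {1, v, z}) (by simp) (by simp)
      (by rintro w (rfl | rfl | rfl); exacts [isIntegral_one, hv, hz]) hx hy
  have hCJ : C ≤ J * J := by
    refine Submodule.le_of_le_smul_of_le_jacobson_bot (I := maximalIdeal R)
      (Submodule.fg_span (by simp)) (by rw [jacobson_eq_maximalIdeal _ bot_ne_top]) ?_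
    set N := J * J ⊔ maximalIdeal R • C with hN
    have hM : ∀ m ∈ maximalIdeal R, ∀ w ∈ C, algebraMap R K m * w ∈ N := fun m hm w hw => by
      rw [← Algebra.smul_def]
      exact Submodule.mem_sup_right (Submodule.smul_mem_smul hm hw)
    have hR : ∀ (r : R), ∀ w ∈ N, algebraMap R K r * w ∈ N := fun r w hw => by
      rw [← Algebra.smul_def]; exact N.smul_mem r hw
    have hJJ : ∀ p ∈ J, ∀ q ∈ J, p * q ∈ N := fun p hp q hq =>
      Submodule.mem_sup_left (Submodule.mul_mem_mul hp hq)
    -- Modulo the maximal ideal, `z² = z`, `zv = 0` and `v² = fv`, so `(z + v)(1 - z)`, `(1 - z)²`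
    -- and `(z + v)²` become `v`, `1 - z` and `z + fv`.
    have hvN : v ∈ N := by
      have := N.add_mem (N.add_mem (hJJ _ hx _ hy) (hM _ hl z hzC)) (hM _ (add_mem hμ ha) 1 h1C)
      convert this using 1
      simp only [map_sub, map_add, map_one]
      linear_combination hsq + hzv
    have h1zN : 1 - z ∈ N := by
      have := N.sub_mem (N.sub_mem (hJJ _ hy _ hy) (hM _ hl z hzC)) (hM _ hμ 1 h1C)
      convert this using 1
      simp only [map_sub, map_one]
      linear_combination -hsq
    have hzN : z ∈ N := by
      have := N.sub_mem (N.sub_mem (N.sub_mem (hJJ _ hx _ hx) (hM _ hl z hzC))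
        (hM _ (add_mem (add_mem hμ (add_mem ha ha)) he) 1 h1C)) (hR f v hvN)
      convert this using 1
      simp only [map_sub, map_add, map_one]
      linear_combination -hsq - 2 * hzv - hvsq
    have h1N : (1 : K) ∈ N := by simpa using N.add_mem h1zN hzN
    rw [hC, Submodule.span_le]
    rintro w (rfl | rfl | rfl)
    exacts [h1N, hvN, hzN]
  have hJst : J.IsStable := by
    refine hst.isStable_of_fg (fun h => ?_) (Submodule.fg_span (by simp))
    have := hCJ h1C
    simp [h] at this
  have h1J : (1 : K) ∈ J := by
    have : J * (J / (J * J)) ≤ J := Submodule.mul_le.2 fun j hj n hn => by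
      rw [mul_comm]
      exact Submodule.mem_div_iff_forall_mul_mem.1 hn j (hCJ (hJC hj))
    exact this hJst
  obtain ⟨p, q, hpq⟩ := Submodule.mem_span_pair.1 h1J
  simp only [Algebra.smul_def] at hpq
  by_cases hp : IsUnit p
  · obtain ⟨p', hp'⟩ := hp.exists_right_inv
    have hp'' : algebraMap R K p * algebraMap R K p' = 1 := by rw [← map_mul, hp', map_one]
    refine ⟨p' * (1 - q), p' * (q - p), ?_⟩
    simp only [map_sub, map_mul, map_one]
    linear_combination algebraMap R K p' * hpq - v * hp''
  · exfalso
    refine hz1 (HasIntegralInverse.of_mul (y := algebraMap R K q) isIntegral_algebraMap ?_)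
    convert hst.hasIntegralInverse_one_add (neg_mem hp : -p ∈ maximalIdeal R) (hz.add hv) using 1
    rw [map_neg]
    linear_combination hpq

/-- If neither `z` nor `1 - z` is a unit of the integral closure of `R`, then the integral
closure is `R + R z`. -/
theorem HasStableFractionalIdeals.exists_eq_add_mul (hst : HasStableFractionalIdeals R K)
    {z v : K} (hz : IsIntegral R z) (hv : IsIntegral R v) (hz0 : ¬ HasIntegralInverse R z)
    (hz1 : ¬ HasIntegralInverse R (1 - z)) :
    ∃ p q : R, v = algebraMap R K p + algebraMap R K q * z := by
  obtain ⟨a, b, c, h⟩ := hst.exists_mul_eq hz hv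
  -- Translating `v` by an element of `R` removes the `z` term, so `(z - b) w ∈ R`. The residue of
  -- `b` decides: if it is `0` or `1`, `z - b` or `b - z` replaces `z` in the previous lemma;
  -- otherwise `z - b` has unit norm and is inverted by its conjugate.
  suffices hw : ∀ w a b : _, IsIntegral R w → z * w = algebraMap R K a + algebraMap R K b * w →
      ∃ p q : R, w = algebraMap R K p + algebraMap R K q * z by
    obtain ⟨p, q, hpq⟩ := hw (v - algebraMap R K b) (a + b * c) c
      (hv.sub isIntegral_algebraMap) (by
        simp only [map_add, map_mul]; linear_combination h)
    exact ⟨p + b, q, by rw [map_add]; linear_combination hpq⟩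
  clear h a b c hv v
  intro v a b hv h
  by_cases hb : b ∈ maximalIdeal R
  · obtain ⟨p, q, hpq⟩ := hst.exists_eq_add_mul_of_mul_eq (z := z - algebraMap R K b) (v := v)
      (hz.sub isIntegral_algebraMap) hv
      (fun h' => hz0 (hst.hasIntegralInverse_of_add (neg_mem hb) h' (by rw [map_neg]; ring)))
      (fun h' => hz1 (hst.hasIntegralInverse_of_add hb h' (by ring)))
      (a := a) (by linear_combination h)
    refine ⟨p - q * b, q, ?_⟩
    rw [map_sub, map_mul]
    linear_combination hpq
  by_cases hb1 : 1 - b ∈ maximalIdeal R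
  · obtain ⟨p, q, hpq⟩ := hst.exists_eq_add_mul_of_mul_eq (z := algebraMap R K b - z) (v := v)
      (isIntegral_algebraMap.sub hz) hv
      (fun h' => hz1 (hst.hasIntegralInverse_of_add (neg_mem hb1) h'
        (by rw [map_neg, map_sub, map_one]; ring)))
      (fun h' => hz0 (hst.hasIntegralInverse_of_add hb1 h'
        (by rw [map_sub, map_one]; ring)))
      (a := -a) (by rw [map_neg]; linear_combination -h)
    refine ⟨p + q * b, -q, ?_⟩
    rw [map_add, map_mul, map_neg]
    linear_combination hpq
  · obtain ⟨μ, l, hsq⟩ := hst.exists_sq_eq hz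
    have hμ : μ ∈ maximalIdeal R := mem_maximalIdeal_of_sq_eq hz hz0 hsq
    have hl : l - 1 ∈ maximalIdeal R := sub_one_mem_maximalIdeal_of_sq_eq hz hz0 hz1 hsq
    have hu : IsUnit (μ + l * b - b ^ 2) := by
      by_contra hn
      have h1 : μ + l * b - b ^ 2 ∈ maximalIdeal R := hn
      have h2 : b * (1 - b) ∈ maximalIdeal R := by
        have := Ideal.sub_mem _ (Ideal.sub_mem _ h1 hμ) (Ideal.mul_mem_right b _ hl)
        convert this using 1; ring
      rcases (Ideal.IsPrime.mem_or_mem inferInstance h2) with h | h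
      exacts [hb h, hb1 h]
    obtain ⟨u, hu⟩ := hu.exists_right_inv
    have hu' := congrArg (algebraMap R K) hu
    simp only [map_sub, map_add, map_mul, map_one, map_pow] at hu'
    refine ⟨u * a * (b - l), u * a, ?_⟩
    simp only [map_mul, map_sub]
    linear_combination -v * hu' - algebraMap R K u * v * hsq
      + algebraMap R K u * (z + algebraMap R K b - algebraMap R K l) * h

end Local

/-! ### Divisibility in the integral closure in dimension one -/

section LocalArchimedean

variable {R K : Type*} [CommRing R] [Field K] [Algebra R K] [IsFractionRing R K] [IsLocalRing R]

open IsLocalRing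

/-- One of `x₁`, `x₂`, `x₁ + x₂` divides both over the integral closure, by the trichotomy for `x₂ /
x₁`. The divisor is an `R`-combination, so it stays in any ideal containing both. -/
theorem HasStableFractionalIdeals.exists_common_divisor (hst : HasStableFractionalIdeals R K)
    (x₁ x₂ : K) : ∃ p q : R, ∃ u₁ u₂ : K, IsIntegral R u₁ ∧ IsIntegral R u₂ ∧
      x₁ = (algebraMap R K p * x₁ + algebraMap R K q * x₂) * u₁ ∧
      x₂ = (algebraMap R K p * x₁ + algebraMap R K q * x₂) * u₂ := by
  rcases eq_or_ne x₁ 0 with rfl | hx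
  · exact ⟨0, 1, 0, 1, isIntegral_zero, isIntegral_one, by simp, by simp⟩
  rcases hst.isIntegral_or_inv (x₂ / x₁) with h | ⟨h0, h⟩ | ⟨h0, h⟩
  · exact ⟨1, 0, 1, x₂ / x₁, isIntegral_one, h, by simp, by simp; field_simp⟩
  · have hx₂ : x₂ ≠ 0 := by rintro rfl; simp at h0
    refine ⟨0, 1, (x₂ / x₁)⁻¹, 1, h, isIntegral_one, by simp; field_simp, by simp⟩
  · have hs : x₁ + x₂ ≠ 0 := fun hs => h0 (by field_simp; simpa using hs)
    refine ⟨1, 1, (1 + x₂ / x₁)⁻¹, 1 - (1 + x₂ / x₁)⁻¹, h, isIntegral_one.sub h, ?_, ?_⟩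
    · simp only [map_one, one_mul]; field_simp
    · simp only [map_one, one_mul]; field_simp; ring

/-- Every nonzero element of the local ring `R` divides a power of each element of the
maximal ideal. -/
def PowersDivisible (R : Type*) [CommRing R] [IsLocalRing R] : Prop :=
  ∀ m ∈ maximalIdeal R, ∀ c : R, c ≠ 0 → ∃ n : ℕ, c ∣ m ^ n

/-- Let `g² = μ + lg` with `g` not invertible, so `μ` is a nonunit. If `l` is a unit, `c ∣ μᵏ = gᵏ(g
- l)ᵏ` and `gᵏ⁺¹ ∣ c` force `g ∣ (g - l)ᵏ`, hence `g` divides a power of `-l`. If `l` is a nonunit,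
`c` divides a power of `g` while a higher power of `g` divides `c`. -/
theorem HasStableFractionalIdeals.hasIntegralInverse_of_forall_pow_dvd
    (hst : HasStableFractionalIdeals R K) (harch : PowersDivisible R) {c : R} (hc : c ≠ 0)
    {g : K} (hg : IsIntegral R g) 
    (h : ∀ n : ℕ, ∃ ρ : R, algebraMap R K c = algebraMap R K ρ * g ^ n) :
    HasIntegralInverse R g := by
  by_contra hu
  obtain ⟨μ, l, hsq⟩ := hst.exists_sq_eq hg
  have hμ : μ ∈ maximalIdeal R := mem_maximalIdeal_of_sq_eq hg hu hsq
  obtain ⟨k, d, hd⟩ := harch μ hμ c hc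
  have hc' : algebraMap R K c ≠ 0 := by
    simpa using (IsFractionRing.injective R K).ne hc
  let B := integralClosure R K
  let g' : B := ⟨g, hg⟩
  have hsq' : g' * g' = algebraMap R B μ + algebraMap R B l * g' := Subtype.ext hsq
  by_cases hl : IsUnit l
  · obtain ⟨ρ, hρ⟩ := h (k + 1)
    obtain ⟨w, hw⟩ := sub_dvd_pow_sub_pow (g' - algebraMap R B l) (-algebraMap R B l) k
    have hw' := congrArg Subtype.val hw
    simp only [sub_neg_eq_add, sub_add_cancel] at hw'
    have e1 : (g - algebraMap R K l) ^ k - (-algebraMap R K l) ^ k = g * w := hw'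
    have hg0 : g ≠ 0 := by
      rintro rfl
      rw [hρ] at hc'
      simp at hc'
    have e2 : (g * (g - algebraMap R K l)) ^ k = algebraMap R K c * algebraMap R K d := by
      rw [← map_mul, ← hd, map_pow]
      congr 1
      linear_combination hsq
    have e3 : (g - algebraMap R K l) ^ k = algebraMap R K ρ * g * algebraMap R K d := by
      have : g ^ k * (g - algebraMap R K l) ^ k =
          g ^ k * (algebraMap R K ρ * g * algebraMap R K d) := by
        rw [← mul_pow, e2, hρ]; ring
      exact mul_left_cancel₀ (pow_ne_zero _ hg0) this
    refine hu (HasIntegralInverse.of_mul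
      (y := algebraMap R K ρ * algebraMap R K d - (w : K))
      ((isIntegral_algebraMap.mul isIntegral_algebraMap).sub w.2) ?_)
    convert ((hl.neg).pow k).hasIntegralInverse (K := K) using 1
    rw [map_pow, map_neg]
    linear_combination e1 - e3
  · obtain ⟨k', d', hd'⟩ := harch l hl c hc
    have hmem : (g' * g') ^ (k + k' - 1) ∈ Ideal.span {algebraMap R B c} := by
      rw [hsq']
      refine Ideal.add_pow_add_pred_mem_of_pow_mem _ ?_ ?_
      · rw [← map_pow, hd, map_mul]
        exact Ideal.mul_mem_right _ _ (Ideal.mem_span_singleton_self _)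
      · rw [mul_pow, ← map_pow, hd', map_mul]
        exact Ideal.mul_mem_right _ _ (Ideal.mul_mem_right _ _ (Ideal.mem_span_singleton_self _))
    obtain ⟨w, hw⟩ := Ideal.mem_span_singleton.1 hmem
    have hw' : (g * g) ^ (k + k' - 1) = algebraMap R K c * w := congrArg Subtype.val hw
    obtain ⟨ρ, hρ⟩ := h (2 * (k + k' - 1) + 1)
    have : g * (algebraMap R K ρ * w) = 1 := by
      apply mul_left_cancel₀ hc'
      rw [pow_succ, pow_mul, pow_two, hw'] at hρ
      linear_combination -hρ
    exact hu (.of_mul_eq_one this (isIntegral_algebraMap.mul w.2))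

/-- Multipliers of a nonzero ideal into itself are integral. -/
theorem HasStableFractionalIdeals.isIntegral_of_mul_mem
    (hst : HasStableFractionalIdeals R K) (harch : PowersDivisible R) {I : Ideal R} (hI : I ≠ ⊥)
    {e : K} (he : ∀ i ∈ I, ∃ j ∈ I, e * algebraMap R K i = algebraMap R K j) :
    IsIntegral R e := by
  obtain ⟨c, hcI, hc⟩ := Submodule.exists_mem_ne_zero_of_ne_bot hI
  have main : ∀ e : K, (∀ i ∈ I, ∃ j ∈ I, e * algebraMap R K i = algebraMap R K j) →
      e ≠ 0 → IsIntegral R e⁻¹ → IsIntegral R e := by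
    intro e he he0 hint
    have : HasIntegralInverse R e⁻¹ := by
      -- All `eⁿ c` stay in `I`, so every power of `e⁻¹` divides `c`.
      refine hst.hasIntegralInverse_of_forall_pow_dvd harch hc hint fun n => ?_
      have hpow : ∃ ρ ∈ I, e ^ n * algebraMap R K c = algebraMap R K ρ := by
        induction n with
        | zero => exact ⟨c, hcI, by simp⟩
        | succ n ih =>
          obtain ⟨ρ, hρ, h⟩ := ih
          obtain ⟨σ, hσ, h'⟩ := he ρ hρ
          exact ⟨σ, hσ, by rw [pow_succ', mul_assoc, h, h']⟩
      obtain ⟨ρ, -, h⟩ := hpow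
      refine ⟨ρ, ?_⟩
      rw [← h, inv_pow]; field_simp
    simpa using this.2
  rcases hst.isIntegral_or_inv e with h | ⟨h0, h⟩ | ⟨h0, h⟩
  · exact h
  · exact main e he h0 h
  · have h1 : IsIntegral R (1 + e) := by
      refine main (1 + e) (fun i hi => ?_) h0 h
      obtain ⟨j, hj, h⟩ := he i hi
      exact ⟨i + j, I.add_mem hi hj, by rw [map_add, ← h]; ring⟩
    simpa using h1.sub (isIntegral_one (R := R) (B := K))

/-- Every nonzero ideal `I` contains an element `x` with `I / x` integral over `R`. -/
theorem HasStableFractionalIdeals.exists_dvd_integral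
    (hst : HasStableFractionalIdeals R K) (harch : PowersDivisible R) {I : Ideal R}
    (hI : I ≠ ⊥) : ∃ x ∈ I, x ≠ 0 ∧
      ∀ i ∈ I, ∃ u : K, IsIntegral R u ∧ algebraMap R K i = algebraMap R K x * u := by
  have hinj := IsFractionRing.injective R K
  set J : Submodule R K := Submodule.map (Algebra.linearMap R K) I with hJ
  have hmem : ∀ y, y ∈ J ↔ ∃ i ∈ I, algebraMap R K i = y := fun y => Ideal.mem_map_linearMap
  -- For `w = xn` with `n ∈ (J : J²)`, each `n i` multiplies `I` into itself, hence is integral.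
  -- Sums are absorbed by a common divisor, and the case `w = 1` is the claim.
  have key : ∀ w ∈ J * (J / (J * J)), ∃ x ∈ I, ∀ i ∈ I, ∃ u : K, IsIntegral R u ∧
      w * algebraMap R K i = algebraMap R K x * u := by
    intro w hw
    induction hw using Submodule.mul_induction_on' with
    | mem_mul_mem y hy n hn =>
      obtain ⟨x, hx, rfl⟩ := (hmem y).1 hy
      refine ⟨x, hx, fun i hi => ⟨n * algebraMap R K i, ?_, by ring⟩⟩
      refine hst.isIntegral_of_mul_mem harch hI fun j hj => ?_
      obtain ⟨k, hk, h⟩ := (hmem _).1 (Submodule.mem_div_mul_self.1 hn _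
        ((hmem _).2 ⟨i, hi, rfl⟩) _ ((hmem _).2 ⟨j, hj, rfl⟩))
      exact ⟨k, hk, by rw [h]; ring⟩
    | add w₁ _ w₂ _ ih₁ ih₂ =>
      obtain ⟨x₁, hx₁, h₁⟩ := ih₁
      obtain ⟨x₂, hx₂, h₂⟩ := ih₂
      obtain ⟨p, q, u₁, u₂, hu₁, hu₂, e₁, e₂⟩ :=
        hst.exists_common_divisor (algebraMap R K x₁) (algebraMap R K x₂)
      refine ⟨p * x₁ + q * x₂, I.add_mem (I.mul_mem_left _ hx₁) (I.mul_mem_left _ hx₂),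
        fun i hi => ?_⟩
      obtain ⟨v₁, hv₁, f₁⟩ := h₁ i hi
      obtain ⟨v₂, hv₂, f₂⟩ := h₂ i hi
      refine ⟨u₁ * v₁ + u₂ * v₂, (hu₁.mul hv₁).add (hu₂.mul hv₂), ?_⟩
      simp only [map_add, map_mul]
      linear_combination f₁ + f₂ + v₁ * e₁ + v₂ * e₂
  obtain ⟨x, hx, h⟩ := key 1 (hst.map_linearMap hI)
  simp only [one_mul] at h
  refine ⟨x, hx, ?_, h⟩
  rintro rfl
  obtain ⟨c, hcI, hc⟩ := Submodule.exists_mem_ne_zero_of_ne_bot hI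
  obtain ⟨u, -, hu⟩ := h c hcI
  exact hc (hinj (by simpa using hu))

end LocalArchimedean

/-! ### Two generators in the local case -/

section LocalMain

variable {R K : Type*} [CommRing R] [Field K] [Algebra R K] [IsFractionRing R K] [IsLocalRing R]

open IsLocalRing

/-- The case where the integral closure of `R` is not local. -/
theorem HasStableFractionalIdeals.exists_minimal_of_not_hasIntegralInverse
    (hst : HasStableFractionalIdeals R K) (harch : PowersDivisible R) {L : Submodule R K}
    (h1 : (1 : K) ∈ L) (hL : ∀ v ∈ L, IsIntegral R v) {z : K} (hz : IsIntegral R z)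
    (hz0 : ¬ HasIntegralInverse R z) (hz1 : ¬ HasIntegralInverse R (1 - z)) :
    ∃ v₀ ∈ L, ∀ r : R, algebraMap R K r * v₀ ∈ Set.range (algebraMap R K) →
      ∀ v ∈ L, algebraMap R K r * v ∈ Set.range (algebraMap R K) := by
  let A : Ideal R := L.comap ((LinearMap.mulRight R z).comp (Algebra.linearMap R K))
  have hA : ∀ a, a ∈ A ↔ algebraMap R K a * z ∈ L := fun a => Iff.rfl
  have hLA : ∀ v ∈ L, ∃ p q : R, q ∈ A ∧ v = algebraMap R K p + algebraMap R K q * z := by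
    intro v hv
    obtain ⟨p, q, rfl⟩ := hst.exists_eq_add_mul hz (hL v hv) hz0 hz1
    refine ⟨p, q, (hA q).2 ?_, rfl⟩
    have := L.sub_mem hv (L.smul_mem p h1)
    simpa [Algebra.smul_def] using this
  rcases eq_or_ne A ⊥ with hbot | hbot
  · refine ⟨0, L.zero_mem, fun r _ v hv => ?_⟩
    obtain ⟨p, q, hq, rfl⟩ := hLA v hv
    rw [hbot, Submodule.mem_bot] at hq
    exact ⟨r * p, by simp [hq]⟩
  · obtain ⟨a, ha, -, hdvd⟩ := hst.exists_dvd_integral harch hbot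
    refine ⟨algebraMap R K a * z, ha, fun r hr v hv => ?_⟩
    obtain ⟨p, q, hq, rfl⟩ := hLA v hv
    obtain ⟨u, hu, hqu⟩ := hdvd q hq
    have := hst.mul_mul_mem (r := algebraMap R K (r * a)) hz hu ⟨_, rfl⟩
      (by rw [map_mul, mul_assoc]; exact hr)
      ⟨r * q, by rw [map_mul, map_mul, hqu]; ring⟩
    obtain ⟨y, hy⟩ := this
    refine ⟨r * p + y, ?_⟩
    rw [map_add, map_mul, hy, hqu, map_mul]
    ring

/-- The case where the integral closure of `R` is local. -/
theorem HasStableFractionalIdeals.exists_minimal_of_hasIntegralInverse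
    (hst : HasStableFractionalIdeals R K) (harch : PowersDivisible R)
    (hM : maximalIdeal R ≠ ⊥) {L : Submodule R K}
    (h1 : (1 : K) ∈ L) (hL : ∀ v ∈ L, IsIntegral R v)
    {c : R} (hc : c ≠ 0) (hcL : ∀ v ∈ L, algebraMap R K c * v ∈ Set.range (algebraMap R K))
    (hloc : ∀ z : K, IsIntegral R z → HasIntegralInverse R z ∨ HasIntegralInverse R (1 - z)) :
    ∃ v₀ ∈ L, ∀ r : R, algebraMap R K r * v₀ ∈ Set.range (algebraMap R K) →
      ∀ v ∈ L, algebraMap R K r * v ∈ Set.range (algebraMap R K) := by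
  have hinj := IsFractionRing.injective R K
  -- Locality of the integral closure turns the trichotomy into the valuation property.
  have val : ∀ t : K, IsIntegral R t ∨ IsIntegral R t⁻¹ := by
    intro t
    rcases hst.isIntegral_or_inv t with h | ⟨-, h⟩ | ⟨h0, h⟩
    · exact Or.inl h
    · exact Or.inr h
    · rcases hloc _ h with ⟨-, h'⟩ | ⟨h1, h'⟩
      · left
        simpa using h'.sub (isIntegral_one (R := R) (B := K))
      · right
        have e : 1 - (1 + t)⁻¹ = t * (1 + t)⁻¹ := by field_simp; ring
        rw [e] at h' h1
        have ht : t ≠ 0 := left_ne_zero_of_mul h1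
        have e' : t⁻¹ = (t * (1 + t)⁻¹)⁻¹ - 1 := by field_simp; ring
        rw [e']
        exact h'.sub isIntegral_one
  obtain ⟨π, hπ, hπ0, hdvd⟩ := hst.exists_dvd_integral harch hM
  have hsq : ∀ h : K, IsIntegral R h → ¬ HasIntegralInverse R h →
      ∃ u : K, IsIntegral R u ∧ h * h = algebraMap R K π * u := by
    intro h hh hu
    obtain ⟨a, b, e⟩ := hst.exists_sq_eq hh
    obtain ⟨u, hu1, hua⟩ := hdvd a (mem_maximalIdeal_of_sq_eq hh hu e)
    by_cases hb : IsUnit b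
    · obtain ⟨d, hd⟩ := hb.exists_right_inv
      have hd' : algebraMap R K b * algebraMap R K d = 1 := by rw [← map_mul, hd, map_one]
      have hh' : IsIntegral R (h * algebraMap R K d) := hh.mul isIntegral_algebraMap
      have := (hloc _ hh').resolve_left fun h' => hu (.of_mul isIntegral_algebraMap h')
      have h0 := this.1
      refine ⟨-u * algebraMap R K d * (1 - h * algebraMap R K d)⁻¹ * h,
        (((hu1.neg).mul isIntegral_algebraMap).mul this.2).mul hh, ?_⟩
      field_simp
      linear_combination h * algebraMap R K d * (-1) * e - h * algebraMap R K d * hua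
        - h * h * hd'
    · obtain ⟨w, hw, hwb⟩ := hdvd b hb
      exact ⟨u + w * h, hu1.add (hw.mul hh), by rw [e, hua, hwb]; ring⟩
  -- By the valuation property, divisibility by `π` of a product of two nonunits reduces to that of
  -- a square.
  have hprod : ∀ g h : K, IsIntegral R g → IsIntegral R h → ¬ HasIntegralInverse R g →
      ¬ HasIntegralInverse R h → ∃ u : K, IsIntegral R u ∧ g * h = algebraMap R K π * u := by
    intro g h hg hh hgu hhu
    rcases eq_or_ne g 0 with rfl | hg0
    · exact ⟨0, isIntegral_zero, by simp⟩
    rcases eq_or_ne h 0 with rfl | hh0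
    · exact ⟨0, isIntegral_zero, by simp⟩
    rcases val (g / h) with hv | hv
    · obtain ⟨u, hu, e⟩ := hsq h hh hhu
      exact ⟨u * (g / h), hu.mul hv, by rw [← mul_assoc, ← e]; field_simp⟩
    · obtain ⟨u, hu, e⟩ := hsq g hg hgu
      exact ⟨u * (g / h)⁻¹, hu.mul hv, by rw [← mul_assoc, ← e]; field_simp⟩
  have quot : ∀ v ∈ L, ∀ r s : R, algebraMap R K r * v ∉ Set.range (algebraMap R K) →
      algebraMap R K s * v ∈ Set.range (algebraMap R K) →
      ∃ h : K, IsIntegral R h ∧ ¬ HasIntegralInverse R h ∧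
        algebraMap R K s = algebraMap R K r * h := by
    intro v hv r s hr hs
    have hr0 : algebraMap R K r ≠ 0 := fun h => hr ⟨0, by simp [h]⟩
    have hni : ∀ t : K, IsIntegral R t → algebraMap R K r ≠ algebraMap R K s * t := by
      intro t ht e
      have := hst.mul_mul_mem (r := algebraMap R K s) (hL v hv) ht ⟨s, rfl⟩ hs ⟨r, e⟩
      exact hr (e ▸ this)
    rcases eq_or_ne (algebraMap R K s) 0 with hs0 | hs0
    · exact ⟨0, isIntegral_zero, fun h => h.1 rfl, by simp [hs0]⟩
    refine ⟨algebraMap R K s / algebraMap R K r, (val _).resolve_right fun h => hni _ h ?_,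
      fun h => hni _ h.2 ?_, ?_⟩ <;> field_simp
  by_contra! hcon
  -- Each failure of minimality gains a nonunit factor by `quot`, so two failures gain a factor `π`.
  -- The conductor element `c` is eventually divisible by `πⁿ⁺¹` although `c ∣ πⁿ`.
  have descend : ∀ n : ℕ, ∃ v ∈ L, ∀ s : R,
      algebraMap R K s * v ∈ Set.range (algebraMap R K) →
      ∃ u : K, IsIntegral R u ∧ algebraMap R K s = algebraMap R K π ^ n * u := by
    intro n
    induction n with
    | zero => exact ⟨1, h1, fun s _ => ⟨algebraMap R K s, isIntegral_algebraMap, by simp⟩⟩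
    | succ n ih =>
      obtain ⟨v, hv, hvn⟩ := ih
      obtain ⟨r, hrv, w, hw, hrw⟩ := hcon v hv
      obtain ⟨r', hr'w, u, hu, hr'u⟩ := hcon w hw
      refine ⟨u, hu, fun s hs => ?_⟩
      obtain ⟨g, hg, hgu, eg⟩ := quot w hw r r' hrw hr'w
      obtain ⟨h, hh, hhu, eh⟩ := quot u hu r' s hr'u hs
      obtain ⟨x, hx, ex⟩ := hvn r hrv
      obtain ⟨y, hy, ey⟩ := hprod g h hg hh hgu hhu
      refine ⟨x * y, hx.mul hy, ?_⟩
      rw [eh, eg, mul_assoc, ey, ex]; ring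
  obtain ⟨n, d, hd⟩ := harch π hπ c hc
  obtain ⟨v, hv, hvn⟩ := descend (n + 1)
  obtain ⟨u, hu, e⟩ := hvn c (hcL v hv)
  refine hst.mul_ne_one hπ (isIntegral_algebraMap.mul hu :
    IsIntegral R (algebraMap R K d * u)) ?_
  have hc' : algebraMap R K c ≠ 0 := by simpa using hinj.ne hc
  apply mul_left_cancel₀ hc'
  have hd' := congrArg (algebraMap R K) hd
  rw [map_pow, map_mul] at hd'
  rw [pow_succ, hd'] at e
  linear_combination -e

/-- Nonzero ideals of a local stable one-dimensional domain are `2`-`v`-generated. -/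
theorem HasStableFractionalIdeals.exists_pair (hst : HasStableFractionalIdeals R K)
    (harch : PowersDivisible R) (hM : maximalIdeal R ≠ ⊥) {I : Ideal R} (hI : I ≠ ⊥) :
    ∃ a ∈ I, a ≠ 0 ∧ ∃ b ∈ I, ∀ y : K, y * algebraMap R K a ∈ Set.range (algebraMap R K) →
      y * algebraMap R K b ∈ Set.range (algebraMap R K) →
      ∀ i ∈ I, y * algebraMap R K i ∈ Set.range (algebraMap R K) := by
  have hinj := IsFractionRing.injective R K
  obtain ⟨x, hx, hx0, hdvd⟩ := hst.exists_dvd_integral harch hI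
  have hx0' : algebraMap R K x ≠ 0 := by simpa using hinj.ne hx0
  let L : Submodule R K :=
    Submodule.comap (LinearMap.mulLeft R (algebraMap R K x))
      (Submodule.map (Algebra.linearMap R K) I)
  have hLmem : ∀ v, v ∈ L ↔ ∃ i ∈ I, algebraMap R K i = algebraMap R K x * v := fun v => Iff.rfl
  have h1 : (1 : K) ∈ L := (hLmem 1).2 ⟨x, hx, by simp⟩
  have hL : ∀ v ∈ L, IsIntegral R v := by
    intro v hv
    obtain ⟨i, hi, e⟩ := (hLmem v).1 hv
    obtain ⟨u, hu, e'⟩ := hdvd i hi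
    rw [mul_left_cancel₀ hx0' (e.symm.trans e')]
    exact hu
  have hxL : ∀ v ∈ L, algebraMap R K x * v ∈ Set.range (algebraMap R K) := by
    intro v hv
    obtain ⟨i, -, e⟩ := (hLmem v).1 hv
    exact ⟨i, e⟩
  obtain ⟨v₀, hv₀, hmin⟩ : ∃ v₀ ∈ L, ∀ r : R,
      algebraMap R K r * v₀ ∈ Set.range (algebraMap R K) →
      ∀ v ∈ L, algebraMap R K r * v ∈ Set.range (algebraMap R K) := by
    by_cases hloc : ∀ z : K, IsIntegral R z →
        HasIntegralInverse R z ∨ HasIntegralInverse R (1 - z)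
    · exact hst.exists_minimal_of_hasIntegralInverse harch hM h1 hL hx0 hxL hloc
    · push Not at hloc
      obtain ⟨z, hz, hz0, hz1⟩ := hloc
      exact hst.exists_minimal_of_not_hasIntegralInverse harch h1 hL hz hz0 hz1
  obtain ⟨b, hb, eb⟩ := (hLmem v₀).1 hv₀
  refine ⟨x, hx, hx0, b, hb, fun y hya hyb i hi => ?_⟩
  obtain ⟨r, hr⟩ := hya
  have := hmin r (by rw [hr, mul_assoc, ← eb]; exact hyb) (algebraMap R K i / algebraMap R K x)
    ((hLmem _).2 ⟨i, hi, by field_simp⟩)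
  convert this using 1
  rw [hr]; field_simp

end LocalMain

/-! ### From projectivity to `1 ∈ J (J : J²)` -/

section OfProjective

variable {R K : Type*} [CommRing R] [Field K] [Algebra R K] [IsFractionRing R K]

/-- An ideal which is projective over its endomorphism ring is stable as a submodule of `K`. -/
theorem Ideal.IsStable.map_linearMap {I : Ideal R} (hI : I ≠ ⊥) (hproj : I.IsStable) :
    (Submodule.map (Algebra.linearMap R K) I).IsStable := by
  obtain ⟨c', hc', hc0⟩ := Submodule.exists_mem_ne_zero_of_ne_bot hI
  let c : I := ⟨c', hc'⟩
  have hc : algebraMap R K (c : R) ≠ 0 := by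
    rw [← map_zero (algebraMap R K)]
    exact (IsFractionRing.injective R K).ne hc0
  obtain ⟨s, hs⟩ := Module.projective_def'.1 hproj
  have hcomm : ∀ x y : I, (x : R) • y = (y : R) • x := fun x y =>
    Subtype.ext (mul_comm (x : R) (y : R))
  have hlin : ∀ (r : R) (y i j : I), s (r • y) i j = r • s y i j := by simp
  have hswap : ∀ x y i j : I, (x : R) • s y i j = (y : R) • s x i j := fun x y i j => by
    rw [← hlin, hcomm, hlin]
  -- A splitting `s` has coordinates `s x i`, and commutativity forces `s x i y = b i * x * y`. So
  -- `b i ∈ (J : J²)`, and the splitting identity at `c` becomes `∑ i * b i = 1`.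
  set b : I → K := fun i =>
    algebraMap R K (s c i c : I) / (algebraMap R K c * algebraMap R K c) with hb
  have hbJ : ∀ i x y : I, b i * (algebraMap R K x * algebraMap R K y) =
      algebraMap R K (s x i y : I) := by
    intro i x y
    have e : (c : R) • (c : R) • s x i y = (x : R) • (y : R) • s c i c := by
      rw [← hswap x c i y, smul_comm, ← map_smul, ← map_smul, hcomm c y,
        map_smul, map_smul]
    have e' : (c : R) * (c * (s x i y : I)) = (x : R) * (y * (s c i c : I)) :=
      congrArg Subtype.val e
    have e'' := congrArg (algebraMap R K) e'
    simp only [map_mul] at e''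
    simp only [hb]
    field_simp
    linear_combination -e''
  have hsum : (1 : K) = ∑ i ∈ (s c).support, algebraMap R K i * b i := by
    have e : ∑ i ∈ (s c).support, s c i i = c := by
      have := LinearMap.congr_fun hs c
      simpa [Finsupp.linearCombination_apply, Finsupp.sum] using this
    have e1 : ∀ i : I, algebraMap R K i * b i =
        algebraMap R K (s c i i : I) / algebraMap R K c := by
      intro i
      have := hbJ i c i
      rw [eq_div_iff hc, ← this]; ring
    simp only [e1]
    rw [← Finset.sum_div, eq_div_iff hc, one_mul]
    have := congrArg (fun x : I => algebraMap R K x) e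
    simpa [map_sum] using this.symm
  unfold Submodule.IsStable
  rw [hsum]
  refine Submodule.sum_mem _ fun i _ => Submodule.mul_mem_mul
    (Ideal.mem_map_linearMap.2 ⟨i, i.2, rfl⟩) (Submodule.mem_div_mul_self.2 ?_)
  intro x hx y hy
  obtain ⟨x, hx', rfl⟩ := Ideal.mem_map_linearMap.1 hx
  obtain ⟨y, hy', rfl⟩ := Ideal.mem_map_linearMap.1 hy
  exact Ideal.mem_map_linearMap.2 ⟨_, (s ⟨x, hx'⟩ i ⟨y, hy'⟩).2, (hbJ i ⟨x, hx'⟩ ⟨y, hy'⟩).symm⟩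

theorem HasStableFractionalIdeals.of_ideals
    (h : ∀ I : Ideal R, I ≠ ⊥ → (Submodule.map (Algebra.linearMap R K) I).IsStable) :
    HasStableFractionalIdeals R K := by
  rintro J hJ ⟨d, hd, hdJ⟩
  have := (algebraMap R K).domain_nontrivial
  have hd0 : algebraMap R K d ≠ 0 :=
    IsLocalization.to_map_ne_zero_of_mem_nonZeroDivisors K le_rfl hd
  let I : Ideal R := J.comap ((LinearMap.mulLeft R (algebraMap R K d)⁻¹).comp
    (Algebra.linearMap R K))
  have hI : ∀ r, r ∈ I ↔ (algebraMap R K d)⁻¹ * algebraMap R K r ∈ J := fun r => Iff.rfl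
  set J₁ := Submodule.map (Algebra.linearMap R K) I with hJ₁
  have hJ₁J : ∀ y ∈ J₁, (algebraMap R K d)⁻¹ * y ∈ J := by
    intro y hy
    obtain ⟨i, hi, rfl⟩ := Ideal.mem_map_linearMap.1 hy
    exact hi
  have hJJ₁ : ∀ y ∈ J, algebraMap R K d * y ∈ J₁ := by
    intro y hy
    obtain ⟨i, hi⟩ := hdJ y hy
    rw [Algebra.smul_def] at hi
    refine Ideal.mem_map_linearMap.2 ⟨i, (hI i).2 ?_, hi⟩
    rw [hi]
    simpa [hd0] using hy
  have hle : J₁ * (J₁ / (J₁ * J₁)) ≤ J * (J / (J * J)) := Submodule.mul_le.2 fun m hm n hn => by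
    have e : m * n = ((algebraMap R K d)⁻¹ * m) * (algebraMap R K d * n) := by field_simp
    rw [e]
    refine Submodule.mul_mem_mul (hJ₁J m hm) (Submodule.mem_div_mul_self.2 fun a ha b hb => ?_)
    have := hJ₁J _ (Submodule.mem_div_mul_self.1 hn _ (hJJ₁ a ha) _ (hJJ₁ b hb))
    convert this using 1
    field_simp
  refine hle (h I fun hbot => hJ ((Submodule.eq_bot_iff _).2 fun y hy => ?_))
  have := hJJ₁ y hy
  rw [hJ₁, hbot, Submodule.map_bot, Submodule.mem_bot] at this
  exact (mul_eq_zero.1 this).resolve_left hd0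

theorem IsStableDomain.hasStableFractionalIdeals (h : IsStableDomain R) :
    HasStableFractionalIdeals R K :=
  .of_ideals fun I hI => (h.2 I hI).map_linearMap hI

end OfProjective

/-! ### Passage to localizations -/

section Localization

variable {R K : Type*} [CommRing R] [Field K] [Algebra R K] [IsFractionRing R K]

theorem HasStableFractionalIdeals.localization (hst : HasStableFractionalIdeals R K)
    (S : Submonoid R) (A : Type*) [CommRing A] [Algebra R A] [Algebra A K] [IsScalarTower R A K]
    [IsLocalization S A] [IsFractionRing A K] : HasStableFractionalIdeals A K := by
  refine .of_ideals fun I hI => ?_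
  have hsurj : ∀ x ∈ I, ∃ s ∈ S, ∃ a : R, algebraMap R A a ∈ I ∧
      x * algebraMap R A s = algebraMap R A a := by
    intro x hx
    obtain ⟨⟨a, s⟩, h⟩ := IsLocalization.surj S x
    exact ⟨s, s.2, a, h ▸ I.mul_mem_right _ hx, h⟩
  let I' : Ideal R := I.comap (algebraMap R A)
  have hI' : I' ≠ ⊥ := by
    obtain ⟨x, hx, hx0⟩ := Submodule.exists_mem_ne_zero_of_ne_bot hI
    obtain ⟨s, hs, a, ha, h⟩ := hsurj x hx
    intro hbot
    have ha' : a ∈ I' := ha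
    rw [hbot, Submodule.mem_bot] at ha'
    rw [ha', map_zero] at h
    exact hx0 ((IsLocalization.map_units A (⟨s, hs⟩ : S)).mul_left_eq_zero.1 h)
  set J := Submodule.map (Algebra.linearMap A K) I with hJ
  set J' := Submodule.map (Algebra.linearMap R K) I' with hJ'
  have hJ'J : ∀ y ∈ J', y ∈ J := by
    intro y hy
    obtain ⟨i, hi, rfl⟩ := Ideal.mem_map_linearMap.1 hy
    exact Ideal.mem_map_linearMap.2
      ⟨algebraMap R A i, hi, (IsScalarTower.algebraMap_apply R A K i).symm⟩
  have hle : J' * (J' / (J' * J')) ≤ (J * (J / (J * J))).restrictScalars R := by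
    refine Submodule.mul_le.2 fun m hm n hn => ?_
    rw [Submodule.restrictScalars_mem]
    refine Submodule.mul_mem_mul (hJ'J m hm) ?_
    rw [Submodule.mem_div_mul_self]
    intro x hx y hy
    obtain ⟨x, hxI, rfl⟩ := Ideal.mem_map_linearMap.1 hx
    obtain ⟨y, hyI, rfl⟩ := Ideal.mem_map_linearMap.1 hy
    obtain ⟨s, hs, a, ha, ea⟩ := hsurj x hxI
    obtain ⟨t, ht, b, hb, eb⟩ := hsurj y hyI
    have h := hJ'J _ (Submodule.mem_div_mul_self.1 hn _ (Ideal.mem_map_linearMap.2 ⟨a, ha, rfl⟩)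
      _ (Ideal.mem_map_linearMap.2 ⟨b, hb, rfl⟩))
    obtain ⟨u, hu⟩ := (IsLocalization.map_units A (⟨s * t, S.mul_mem hs ht⟩ : S)).exists_right_inv
    have h2 := J.smul_mem u h
    convert h2 using 1
    rw [Algebra.smul_def, IsScalarTower.algebraMap_apply R A K a, ← ea,
      IsScalarTower.algebraMap_apply R A K b, ← eb]
    have hu' := congrArg (algebraMap A K) hu
    simp only [map_mul, map_one] at hu' ⊢
    linear_combination -(n * algebraMap A K x * algebraMap A K y) * hu'
  exact hle (hst.map_linearMap hI')

theorem powersDivisible_of_dimensionLEOne (A : Type*) [CommRing A] [IsLocalRing A]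
    [Ring.DimensionLEOne A] : PowersDivisible A := by
  intro m hm c hc
  have : m ∈ (Ideal.span {c}).radical := by
    rw [Ideal.radical_eq_sInf, Ideal.mem_sInf]
    rintro P ⟨hcP, hP⟩
    have hP0 : P ≠ ⊥ := by
      rintro rfl
      exact hc (by simpa using hcP (Ideal.mem_span_singleton_self c))
    rw [IsLocalRing.eq_maximalIdeal (Ring.DimensionLEOne.maximalOfPrime hP0 hP)]
    exact hm
  obtain ⟨n, hn⟩ := Ideal.mem_radical_iff.1 this
  exact ⟨n, Ideal.mem_span_singleton.1 hn⟩

end Localization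

/-! ### Membership in localizations inside `K` -/

section IntegralAt

variable {R K : Type*} [CommRing R] [Field K] [Algebra R K]

/-- The element `y` of `K` lies in the localization of `R` at the complement of `M`. -/
def IsIntegralAt (M : Ideal R) (y : K) : Prop :=
  ∃ s : R, s ∉ M ∧ ∃ r : R, algebraMap R K r = algebraMap R K s * y

theorem isIntegralAt_of_mem_range {M : Ideal R} (hM : M ≠ ⊤) {y : K}
    (hy : y ∈ Set.range (algebraMap R K)) : IsIntegralAt M y := by
  obtain ⟨r, rfl⟩ := hy
  exact ⟨1, fun h => hM ((Ideal.eq_top_iff_one _).2 h), r, by simp⟩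

theorem IsIntegralAt.add {M : Ideal R} [M.IsPrime] {x y : K} (hx : IsIntegralAt M x)
    (hy : IsIntegralAt M y) : IsIntegralAt M (x + y) := by
  obtain ⟨s, hs, a, ha⟩ := hx
  obtain ⟨t, ht, b, hb⟩ := hy
  exact ⟨s * t, M.primeCompl.mul_mem hs ht, t * a + s * b, by
    simp only [map_add, map_mul, ha, hb]; ring⟩

theorem IsIntegralAt.algebraMap_mul {M : Ideal R} {y : K} (hy : IsIntegralAt M y) (r : R) :
    IsIntegralAt M (algebraMap R K r * y) := by
  obtain ⟨s, hs, a, ha⟩ := hy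
  exact ⟨s, hs, r * a, by rw [map_mul, ha]; ring⟩

theorem IsIntegralAt.of_algebraMap_mul {M : Ideal R} [M.IsPrime] {y : K} {s : R} (hs : s ∉ M)
    (hy : IsIntegralAt M (algebraMap R K s * y)) : IsIntegralAt M y := by
  obtain ⟨t, ht, a, ha⟩ := hy
  exact ⟨t * s, M.primeCompl.mul_mem ht hs, a, by rw [ha, map_mul]; ring⟩

theorem mem_range_of_forall_isIntegralAt {y : K}
    (h : ∀ M : Ideal R, M.IsMaximal → IsIntegralAt M y) : y ∈ Set.range (algebraMap R K) := by
  let D : Ideal R :=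
    { carrier := {s | ∃ r : R, algebraMap R K r = algebraMap R K s * y}
      zero_mem' := ⟨0, by simp⟩
      add_mem' := by
        rintro s t ⟨a, ha⟩ ⟨b, hb⟩
        exact ⟨a + b, by rw [map_add, map_add, ha, hb, add_mul]⟩
      smul_mem' := by
        rintro c s ⟨a, ha⟩
        exact ⟨c * a, by rw [map_mul, smul_eq_mul, map_mul, ha, mul_assoc]⟩ }
  have hD : D = ⊤ := by
    by_contra hne
    obtain ⟨M, hM, hDM⟩ := Ideal.exists_le_maximal D hne
    obtain ⟨s, hs, hsy⟩ := h M hM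
    exact hs (hDM hsy)
  obtain ⟨r, hr⟩ : (1 : R) ∈ D := hD ▸ Submodule.mem_top
  exact ⟨r, by simpa using hr⟩

theorem isIntegralAt_iff_mem_range (M : Ideal R) [M.IsPrime] (A : Type*) [CommRing A]
    [Algebra R A] [Algebra A K] [IsScalarTower R A K] [IsLocalization.AtPrime A M] {y : K} :
    IsIntegralAt M y ↔ y ∈ Set.range (algebraMap A K) := by
  constructor
  · rintro ⟨s, hs, r, hr⟩
    obtain ⟨u, hu⟩ := (IsLocalization.map_units A (⟨s, hs⟩ : M.primeCompl)).exists_right_inv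
    refine ⟨u * algebraMap R A r, ?_⟩
    have hu' := congrArg (algebraMap A K) hu
    simp only [map_mul, map_one, ← IsScalarTower.algebraMap_apply] at hu'
    rw [map_mul, ← IsScalarTower.algebraMap_apply, hr]
    linear_combination y * hu'
  · rintro ⟨x, rfl⟩
    obtain ⟨⟨a, s⟩, h⟩ := IsLocalization.surj M.primeCompl x
    refine ⟨s, s.2, a, ?_⟩
    rw [IsScalarTower.algebraMap_apply R A K, ← h, map_mul, ← IsScalarTower.algebraMap_apply]
    ring

end IntegralAt

section PairAt

variable {R K : Type*} [CommRing R] [IsDomain R] [Field K] [Algebra R K] [IsFractionRing R K]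

theorem HasStableFractionalIdeals.exists_pair_at [Ring.DimensionLEOne R]
    (hst : HasStableFractionalIdeals R K) (M : Ideal R) [M.IsMaximal] (hM0 : M ≠ ⊥)
    {I : Ideal R} (hI : I ≠ ⊥) : ∃ a ∈ I, a ≠ 0 ∧ ∃ b ∈ I, ∀ y : K,
      IsIntegralAt M (y * algebraMap R K a) → IsIntegralAt M (y * algebraMap R K b) →
      ∀ i ∈ I, IsIntegralAt M (y * algebraMap R K i) := by
  have hle : M.primeCompl ≤ R⁰ := M.primeCompl_le_nonZeroDivisors
  let A := Localization.subalgebra.ofField K M.primeCompl hle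
  have : IsLocalization.AtPrime A M := Localization.subalgebra.isLocalization_ofField _ _ _
  have : IsLocalRing A := IsLocalization.AtPrime.isLocalRing A M
  have : Ring.DimensionLEOne A := Ring.DimensionLEOne.localization A hle
  have hstA : HasStableFractionalIdeals A K := hst.localization M.primeCompl A
  have hinj : Function.Injective (algebraMap R A) := IsLocalization.injective A hle
  have hMA : IsLocalRing.maximalIdeal A ≠ ⊥ := by
    obtain ⟨m, hm, hm0⟩ := Submodule.exists_mem_ne_zero_of_ne_bot hM0
    intro h
    have := (IsLocalization.AtPrime.to_map_mem_maximal_iff A M m).2 hm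
    rw [h, Submodule.mem_bot] at this
    exact hm0 (hinj (by rw [this, map_zero]))
  have hIA : I.map (algebraMap R A) ≠ ⊥ := by
    obtain ⟨i, hi, hi0⟩ := Submodule.exists_mem_ne_zero_of_ne_bot hI
    intro h
    have := Ideal.mem_map_of_mem (algebraMap R A) hi
    rw [h, Submodule.mem_bot] at this
    exact hi0 (hinj (by rw [this, map_zero]))
  obtain ⟨a, ha, ha0, b, hb, hab⟩ :=
    hstA.exists_pair (powersDivisible_of_dimensionLEOne A) hMA hIA
  obtain ⟨⟨a', s⟩, ea⟩ := (IsLocalization.mem_map_algebraMap_iff M.primeCompl A).1 ha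
  obtain ⟨⟨b', t⟩, eb⟩ := (IsLocalization.mem_map_algebraMap_iff M.primeCompl A).1 hb
  have ha'0 : (a' : R) ≠ 0 := fun h => by
    rw [h, map_zero] at ea
    exact ha0 ((IsLocalization.map_units A s).mul_left_eq_zero.1 ea)
  refine ⟨a', a'.2, ha'0, b', b'.2, fun y hya hyb i hi => ?_⟩
  have key : ∀ (x : A) (x' : R) (u : M.primeCompl), x * algebraMap R A u = algebraMap R A x' →
      IsIntegralAt M (y * algebraMap R K x') →
      y * algebraMap A K x ∈ Set.range (algebraMap A K) := by
    intro x x' u e h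
    rw [← isIntegralAt_iff_mem_range M A]
    refine IsIntegralAt.of_algebraMap_mul u.2 ?_
    convert h using 1
    rw [IsScalarTower.algebraMap_apply R A K x', ← e, map_mul, ← IsScalarTower.algebraMap_apply]
    ring
  have := hab y (key a a' s ea hya) (key b b' t eb hyb) _ (Ideal.mem_map_of_mem _ hi)
  rw [← isIntegralAt_iff_mem_range M A, ← IsScalarTower.algebraMap_apply] at this
  exact this

end PairAt

/-! ### Finite character -/

section FiniteCharacter

variable {R K : Type*} [CommRing R] [Field K] [Algebra R K] [IsFractionRing R K]

/-- Otherwise some prime containing `c` avoids all products `s * t`, hence lies in both `M` and `N`;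
being nonzero it is maximal and equals both. -/
theorem exists_dvd_mul_of_ne [Ring.DimensionLEOne R] {M N : Ideal R} [hM : M.IsMaximal]
    [hN : N.IsMaximal] (hMN : M ≠ N) {c : R} (hc : c ≠ 0) :
    ∃ s, s ∉ M ∧ ∃ t, t ∉ N ∧ c ∣ s * t := by
  by_contra! hcon
  have hdisj : Disjoint (Ideal.span {c} : Set R)
      ((M.primeCompl ⊔ N.primeCompl : Submonoid R) : Set R) := by
    rw [Set.disjoint_left]
    intro x hx hx'
    obtain ⟨s, hs, t, ht, rfl⟩ := Submonoid.mem_sup.1 hx'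
    exact hcon s hs t ht (Ideal.mem_span_singleton.1 hx)
  obtain ⟨P, hP, hcP, hPd⟩ := Ideal.exists_le_prime_disjoint _ _ hdisj
  have hP0 : P ≠ ⊥ := by
    rintro rfl
    exact hc (by simpa using hcP (Ideal.mem_span_singleton_self c))
  have hPmax := Ring.DimensionLEOne.maximalOfPrime hP0 hP
  have hle : ∀ Q : Ideal R, [Q.IsPrime] → Q.primeCompl ≤ M.primeCompl ⊔ N.primeCompl → P ≤ Q := by
    intro Q _ hQ x hx
    by_contra hxQ
    exact Set.disjoint_left.1 hPd hx (hQ hxQ)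
  exact hMN ((hPmax.eq_of_le hM.ne_top (hle M le_sup_left)).symm.trans
    (hPmax.eq_of_le hN.ne_top (hle N le_sup_right)))

/-- Every maximal ideal containing `c` is isolated among the maximal ideals containing `c`. -/
theorem HasStableFractionalIdeals.exists_isolating [Ring.DimensionLEOne R]
    (hst : HasStableFractionalIdeals R K) {c : R} (hc : c ≠ 0) (M : Ideal R) [hM : M.IsMaximal] :
    ∃ s, s ∉ M ∧ ∀ N : Ideal R, N.IsMaximal → c ∈ N → N ≠ M → s ∈ N := by
  have hinj := IsFractionRing.injective R K
  have hc' : algebraMap R K c ≠ 0 := by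
    rw [← map_zero (algebraMap R K)]
    exact hinj.ne hc
  -- `I` is the contraction of `c R_M`. It lies in no maximal ideal other than possibly `M`, and its
  -- multiplier ring is `R` (`hend`). Stability then gives `s ∉ M` with `s I ⊆ cR`.
  let I : Ideal R :=
    { carrier := {x | ∃ s, s ∉ M ∧ c ∣ s * x}
      zero_mem' := ⟨1, fun h => hM.ne_top ((Ideal.eq_top_iff_one _).2 h), by simp⟩
      add_mem' := by
        rintro x y ⟨s, hs, hx⟩ ⟨t, ht, hy⟩
        refine ⟨s * t, M.primeCompl.mul_mem hs ht, ?_⟩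
        have : s * t * (x + y) = t * (s * x) + s * (t * y) := by ring
        rw [this]
        exact dvd_add (hx.mul_left _) (hy.mul_left _)
      smul_mem' := by
        rintro r x ⟨s, hs, hx⟩
        exact ⟨s, hs, by rw [smul_eq_mul, mul_left_comm]; exact hx.mul_left _⟩ }
  have hcI : c ∈ I := ⟨1, fun h => hM.ne_top ((Ideal.eq_top_iff_one _).2 h), by simp⟩
  have hI : I ≠ ⊥ := by
    intro h
    rw [h, Submodule.mem_bot] at hcI
    exact hc hcI
  have hIN : ∀ N : Ideal R, N.IsMaximal → N ≠ M → ∃ t ∈ I, t ∉ N := by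
    intro N hN hNM
    obtain ⟨s, hs, t, ht, h⟩ := exists_dvd_mul_of_ne hNM.symm hc
    exact ⟨t, ⟨s, hs, h⟩, ht⟩
  have hend : ∀ e : K, (∀ i ∈ I, ∃ j ∈ I, algebraMap R K j = e * algebraMap R K i) →
      e ∈ Set.range (algebraMap R K) := by
    intro e he
    refine mem_range_of_forall_isIntegralAt fun N hN => ?_
    by_cases hNM : N = M
    · subst hNM
      obtain ⟨j, ⟨s, hs, d, hd⟩, hj⟩ := he c hcI
      refine ⟨s, hs, d, mul_left_cancel₀ hc' ?_⟩
      rw [← map_mul, ← hd, map_mul, hj]; ring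
    · obtain ⟨t, htI, htN⟩ := hIN N hN hNM
      obtain ⟨j, -, hj⟩ := he t htI
      exact ⟨t, htN, j, by rw [hj, mul_comm]⟩
  set J : Submodule R K := Submodule.map (Algebra.linearMap R K) I with hJ
  have hmem : ∀ y, y ∈ J ↔ ∃ i ∈ I, algebraMap R K i = y := fun y => Ideal.mem_map_linearMap
  have key : ∀ w ∈ J * (J / (J * J)), ∃ s, s ∉ M ∧ ∀ i ∈ I, ∃ r,
      algebraMap R K s * w * algebraMap R K i = algebraMap R K c * algebraMap R K r := by
    intro w hw
    induction hw using Submodule.mul_induction_on' with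
    | mem_mul_mem y hy n hn =>
      obtain ⟨x, ⟨s, hs, d, hd⟩, rfl⟩ := (hmem y).1 hy
      refine ⟨s, hs, fun i hi => ?_⟩
      obtain ⟨e, he⟩ := hend (n * algebraMap R K i) fun j hj => by
        obtain ⟨k, hk, h⟩ := (hmem _).1 (Submodule.mem_div_mul_self.1 hn _
          ((hmem _).2 ⟨i, hi, rfl⟩) _ ((hmem _).2 ⟨j, hj, rfl⟩))
        exact ⟨k, hk, by rw [h]; ring⟩
      refine ⟨d * e, ?_⟩
      have hd' := congrArg (algebraMap R K) hd
      simp only [map_mul] at hd' ⊢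
      rw [he]
      linear_combination n * algebraMap R K i * hd'
    | add w₁ _ w₂ _ ih₁ ih₂ =>
      obtain ⟨s₁, hs₁, h₁⟩ := ih₁
      obtain ⟨s₂, hs₂, h₂⟩ := ih₂
      refine ⟨s₁ * s₂, M.primeCompl.mul_mem hs₁ hs₂, fun i hi => ?_⟩
      obtain ⟨r₁, e₁⟩ := h₁ i hi
      obtain ⟨r₂, e₂⟩ := h₂ i hi
      refine ⟨s₂ * r₁ + s₁ * r₂, ?_⟩
      simp only [map_add, map_mul]
      linear_combination algebraMap R K s₂ * e₁ + algebraMap R K s₁ * e₂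
  obtain ⟨s, hs, h⟩ := key 1 (hst.map_linearMap hI)
  refine ⟨s, hs, fun N hN hcN hNM => ?_⟩
  obtain ⟨t, htI, htN⟩ := hIN N hN hNM
  obtain ⟨r, hr⟩ := h t htI
  have hst' : s * t = c * r := hinj (by simpa using hr)
  exact (hN.isPrime.mem_or_mem (hst' ▸ N.mul_mem_right r hcN)).resolve_right htN

/-- A stable one-dimensional domain has finite character. -/
theorem HasStableFractionalIdeals.finite_setOf_isMaximal [Ring.DimensionLEOne R]
    (hst : HasStableFractionalIdeals R K) {c : R} (hc : c ≠ 0) :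
    {M : Ideal R | M.IsMaximal ∧ c ∈ M}.Finite := by
  let X := {M : Ideal R // M.IsMaximal ∧ c ∈ M}
  have hex : ∀ M : X, ∃ s, s ∉ M.1 ∧ ∀ N : Ideal R, N.IsMaximal → c ∈ N → N ≠ M.1 → s ∈ N :=
    fun M => by
      have := M.2.1
      exact hst.exists_isolating hc M.1
  choose s hs hsN using hex
  have htop : Ideal.span (insert c (Set.range s)) = ⊤ := by
    by_contra hne
    obtain ⟨N, hN, hle⟩ := Ideal.exists_le_maximal _ hne
    have hcN : c ∈ N := hle (Ideal.subset_span (Set.mem_insert _ _))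
    exact hs ⟨N, hN, hcN⟩
      (hle (Ideal.subset_span (Set.mem_insert_of_mem _ ⟨⟨N, hN, hcN⟩, rfl⟩)))
  obtain ⟨T, hT, h1⟩ := Submodule.mem_span_finite_of_mem_span
    (show (1 : R) ∈ Submodule.span R (insert c (Set.range s)) from
      (Ideal.eq_top_iff_one _).1 htop)
  -- All generators other than `s M` lie in `M`, so no representation of `1` can omit `s M`.
  have hsT : ∀ M : X, s M ∈ T := by
    intro M
    by_contra hM
    refine M.2.1.ne_top ((Ideal.eq_top_iff_one _).2 ((Submodule.span_le.2 fun t ht => ?_) h1))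
    rcases hT ht with rfl | ⟨N, rfl⟩
    · exact M.2.2
    · refine hsN N M.1 M.2.1 M.2.2 fun h => hM ?_
      rw [show M = N from Subtype.ext h]
      exact ht
  have hinj : Function.Injective fun M : X => (⟨s M, hsT M⟩ : T) := by
    intro M N h
    by_contra hne
    have h' : s M = s N := congrArg Subtype.val h
    exact hs N (h' ▸ hsN M N.1 N.2.1 N.2.2 fun e => hne (Subtype.ext e.symm))
  exact Set.finite_coe_iff.1 (Finite.of_injective _ hinj)

end FiniteCharacter

/-! ### Gluing local pairs -/

section Glue

variable {R K : Type*} [CommRing R] [Field K] [Algebra R K]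

/-- The elements of `R` which lie in `M (a, b)` locally at `M`. -/
def perturbationIdeal (M : Ideal R) [hM : M.IsPrime] (a b : R) : Ideal R where
  carrier := {q | ∃ s, s ∉ M ∧ ∃ m ∈ M, ∃ n ∈ M, s * q = m * a + n * b}
  zero_mem' := ⟨1, fun h => hM.ne_top ((Ideal.eq_top_iff_one _).2 h), 0, M.zero_mem, 0,
    M.zero_mem, by simp⟩
  add_mem' := by
    rintro p q ⟨s, hs, m, hm, n, hn, h⟩ ⟨s', hs', m', hm', n', hn', h'⟩
    exact ⟨s * s', M.primeCompl.mul_mem hs hs', s' * m + s * m',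
      add_mem (M.mul_mem_left _ hm) (M.mul_mem_left _ hm'), s' * n + s * n',
      add_mem (M.mul_mem_left _ hn) (M.mul_mem_left _ hn'), by
        linear_combination s' * h + s * h'⟩
  smul_mem' := by
    rintro r q ⟨s, hs, m, hm, n, hn, h⟩
    exact ⟨s, hs, r * m, M.mul_mem_left _ hm, r * n, M.mul_mem_left _ hn, by
      rw [smul_eq_mul]; linear_combination r * h⟩

theorem mul_mem_perturbationIdeal {M : Ideal R} [hM : M.IsPrime] {a b m : R} (hm : m ∈ M) :
    m * a ∈ perturbationIdeal M a b :=
  ⟨1, fun h => hM.ne_top ((Ideal.eq_top_iff_one _).2 h), m, hm, 0, M.zero_mem, by simp⟩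

/-- After scaling by `s` and `s'`, the pair `a', b'` comes from `a, b` by a matrix congruent to
`diag(s, s')` modulo `M`. Its determinant is outside `M`, and Cramer's rule recovers `a, b`. -/
theorem IsIntegralAt.of_perturbation {M : Ideal R} [M.IsPrime] {a b a' b' : R}
    (ha : a' - a ∈ perturbationIdeal M a b) (hb : b' - b ∈ perturbationIdeal M a b) {y : K}
    (hya : IsIntegralAt M (y * algebraMap R K a')) (hyb : IsIntegralAt M (y * algebraMap R K b')) :
    IsIntegralAt M (y * algebraMap R K a) ∧ IsIntegralAt M (y * algebraMap R K b) := by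
  obtain ⟨s, hs, m, hm, n, hn, h⟩ := ha
  obtain ⟨s', hs', m', hm', n', hn', h'⟩ := hb
  have hδ : (s + m) * (s' + n') - n * m' ∉ M := by
    intro hmem
    have hss : s * s' ∉ M := M.primeCompl.mul_mem hs hs'
    refine hss ?_
    have := M.sub_mem (M.add_mem (M.sub_mem hmem (M.mul_mem_left s hn'))
      (M.mul_mem_right m' hn)) (M.mul_mem_right (s' + n') hm)
    convert this using 1; ring
  have e := congrArg (algebraMap R K) h
  have e' := congrArg (algebraMap R K) h'
  simp only [map_mul, map_add, map_sub] at e e'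
  constructor
  · refine IsIntegralAt.of_algebraMap_mul hδ ?_
    convert (hya.algebraMap_mul ((s' + n') * s)).add (hyb.algebraMap_mul (-(n * s'))) using 1
    simp only [map_mul, map_add, map_sub, map_neg]
    linear_combination y * (-(algebraMap R K s' + algebraMap R K n') * e + algebraMap R K n * e')
  · refine IsIntegralAt.of_algebraMap_mul hδ ?_
    convert (hyb.algebraMap_mul ((s + m) * s')).add (hya.algebraMap_mul (-(m' * s))) using 1
    simp only [map_mul, map_add, map_sub, map_neg]
    linear_combination y * (-(algebraMap R K s + algebraMap R K m) * e' + algebraMap R K m' * e)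

/-- This makes the perturbation ideals at distinct maximal ideals comaximal. -/
theorem eq_of_perturbationIdeal_le [IsDomain R] [Ring.DimensionLEOne R] {M N : Ideal R}
    [hM : M.IsMaximal] [hN : N.IsMaximal] (hM0 : M ≠ ⊥) {a b : R} (ha : a ≠ 0)
    (h : perturbationIdeal M a b ≤ N) : M = N := by
  by_contra hMN
  obtain ⟨m, hm, hm0⟩ := Submodule.exists_mem_ne_zero_of_ne_bot hM0
  obtain ⟨s, hs, t, ht, d, hd⟩ := exists_dvd_mul_of_ne hMN (mul_ne_zero hm0 ha)
  exact ht (h ⟨s, hs, m * d, M.mul_mem_right _ hm, 0, M.zero_mem, by rw [hd]; ring⟩)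

theorem Ideal.mem_of_forall_isMaximal {I : Ideal R} {r : R}
    (h : ∀ N : Ideal R, N.IsMaximal → ∃ t, t ∉ N ∧ t * r ∈ I) : r ∈ I := by
  by_contra hr
  have hne : I.colon {r} ≠ ⊤ := fun htop => hr (by
    have := (Ideal.eq_top_iff_one _).1 htop
    simpa [Submodule.mem_colon_singleton] using this)
  obtain ⟨N, hN, hle⟩ := Ideal.exists_le_maximal _ hne
  obtain ⟨t, ht, htr⟩ := h N hN
  exact ht (hle (Submodule.mem_colon_singleton.2 htr))

/-- Simultaneous approximation, inside the ideal `I`, of local elements of `I`. -/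
theorem exists_mem_forall_sub_mem {I : Ideal R} {T : Set (Ideal R)} (hT : T.Finite)
    (hIT : ∀ M : Ideal R, M.IsMaximal → I ≤ M → M ∈ T)
    (Q : Ideal R → Ideal R)
    (hQ : ∀ M ∈ T, ∀ N : Ideal R, N.IsMaximal → Q M ≤ N → M = N) (x : Ideal R → R)
    (hx : ∀ M : Ideal R, M.IsMaximal → I ≤ M → ∀ r, r - x M ∈ Q M → ∃ t, t ∉ M ∧ t * r ∈ I) :
    ∃ r ∈ I, ∀ M ∈ T, r - x M ∈ Q M := by
  have := hT.to_subtype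
  obtain ⟨r, hr⟩ := Ideal.exists_forall_sub_mem_ideal (I := fun M : T => Q M) (by
    intro M N hMN
    rw [Function.onFun, Ideal.isCoprime_iff_sup_eq]
    by_contra hne
    obtain ⟨P, hP, hle⟩ := Ideal.exists_le_maximal _ hne
    exact hMN (Subtype.ext ((hQ M M.2 P hP (le_sup_left.trans hle)).trans
      (hQ N N.2 P hP (le_sup_right.trans hle)).symm))) (fun M : T => x M)
  refine ⟨r, Ideal.mem_of_forall_isMaximal fun N hN => ?_, fun M hM => hr ⟨M, hM⟩⟩
  by_cases hIN : I ≤ N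
  · exact hx N hN hIN r (hr ⟨N, hIT N hN hIN⟩)
  · obtain ⟨t, ht, htN⟩ := SetLike.not_le_iff_exists.1 hIN
    exact ⟨t, htN, I.mul_mem_right _ ht⟩

variable [IsDomain R] [IsFractionRing R K]

theorem HasStableFractionalIdeals.exists_pair_of_dimensionLEOne [Ring.DimensionLEOne R]
    (hst : HasStableFractionalIdeals R K) (hR : ∀ M : Ideal R, M.IsMaximal → M ≠ ⊥)
    {I : Ideal R} (hI : I ≠ ⊥) : ∃ a ∈ I, ∃ b ∈ I, ∀ y : K,
      y * algebraMap R K a ∈ Set.range (algebraMap R K) →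
      y * algebraMap R K b ∈ Set.range (algebraMap R K) →
      ∀ i ∈ I, y * algebraMap R K i ∈ Set.range (algebraMap R K) := by
  classical
  have hloc : ∀ M : Ideal R, ∃ a b : R, ∃ Q : Ideal R, M.IsMaximal →
      a ∈ I ∧ b ∈ I ∧ (∃ q ∈ Q, q ≠ 0) ∧ (∀ N : Ideal R, N.IsMaximal → Q ≤ N → M = N) ∧
      (∀ q ∈ Q, ∃ t, t ∉ M ∧ t * q ∈ I) ∧
      ∀ a' b' : R, a' - a ∈ Q → b' - b ∈ Q → ∀ y : K, IsIntegralAt M (y * algebraMap R K a') →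
        IsIntegralAt M (y * algebraMap R K b') →
        ∀ i ∈ I, IsIntegralAt M (y * algebraMap R K i) := by
    intro M
    by_cases hM : M.IsMaximal
    · obtain ⟨a, ha, ha0, b, hb, hab⟩ := hst.exists_pair_at M (hR M hM) hI
      obtain ⟨m, hm, hm0⟩ := Submodule.exists_mem_ne_zero_of_ne_bot (hR M hM)
      refine ⟨a, b, perturbationIdeal M a b, fun _ => ⟨ha, hb,
        ⟨m * a, mul_mem_perturbationIdeal hm, mul_ne_zero hm0 ha0⟩,
        fun N hN h => eq_of_perturbationIdeal_le (hR M hM) ha0 h, ?_, ?_⟩⟩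
      · rintro q ⟨s, hs, m, -, n, -, h⟩
        exact ⟨s, hs, h ▸ I.add_mem (I.mul_mem_left _ ha) (I.mul_mem_left _ hb)⟩
      · intro a' b' ha' hb' y hya hyb
        obtain ⟨h1, h2⟩ := IsIntegralAt.of_perturbation ha' hb' hya hyb
        exact hab y h1 h2
    · exact ⟨0, 0, ⊥, fun h => absurd h hM⟩
  choose a b Q hprop using hloc
  have hclear : ∀ M : Ideal R, M.IsMaximal → ∀ x ∈ I, ∀ r, r - x ∈ Q M →
      ∃ t, t ∉ M ∧ t * r ∈ I := by
    intro M hM x hx r hr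
    obtain ⟨t, ht, h⟩ := (hprop M hM).2.2.2.2.1 _ hr
    refine ⟨t, ht, ?_⟩
    have := I.add_mem h (I.mul_mem_left t hx)
    convert this using 1; ring
  obtain ⟨c, hcI, hc0⟩ := Submodule.exists_mem_ne_zero_of_ne_bot hI
  set S : Set (Ideal R) := {M | M.IsMaximal ∧ I ≤ M} with hS
  have hSfin : S.Finite :=
    (hst.finite_setOf_isMaximal hc0).subset fun M hM => ⟨hM.1, hM.2 hcI⟩
  obtain ⟨a₀, ha₀, ha₀0, haQ⟩ : ∃ a₀ ∈ I, a₀ ≠ 0 ∧ ∀ M ∈ S, a₀ - a M ∈ Q M := by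
    obtain ⟨r, hrI, hr⟩ := exists_mem_forall_sub_mem (I := I) hSfin
      (fun M hM h => ⟨hM, h⟩) Q (fun M hM => (hprop M hM.1).2.2.2.1) a
      (fun M hM _ => hclear M hM _ (hprop M hM).1)
    -- `a₀` must be nonzero so that finitely many maximal ideals contain it. If the approximation is
    -- `0`, a nonzero element of `I` lying in every `Q M` replaces it.
    by_cases hr0 : r = 0
    · have hq : ∀ M : Ideal R, ∃ q, q ≠ 0 ∧ (M.IsMaximal → q ∈ Q M) := by
        intro M
        by_cases hM : M.IsMaximal
        · obtain ⟨q, hq, hq0⟩ := (hprop M hM).2.2.1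
          exact ⟨q, hq0, fun _ => hq⟩
        · exact ⟨1, one_ne_zero, fun h => absurd h hM⟩
      choose q hq0 hqQ using hq
      refine ⟨c * ∏ M ∈ hSfin.toFinset, q M, I.mul_mem_right _ hcI,
        mul_ne_zero hc0 (Finset.prod_ne_zero_iff.2 fun M _ => hq0 M), fun M hM => ?_⟩
      have h1 := hr M hM
      rw [hr0, zero_sub] at h1
      rw [sub_eq_add_neg]
      refine (Q M).add_mem ((Q M).mul_mem_left _ ?_) h1
      exact Ideal.mem_of_dvd _ (Finset.dvd_prod_of_mem q (hSfin.mem_toFinset.2 hM)) (hqQ M hM.1)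
    · exact ⟨r, hrI, hr0, hr⟩
  -- At maximal ideals containing `a₀` but not `I`, `b₀` is required to be `1` modulo `M`, so that
  -- one of `a₀`, `b₀` is locally a unit wherever `I` is locally trivial.
  obtain ⟨b₀, hb₀, hbQ⟩ := exists_mem_forall_sub_mem (I := I)
    (hst.finite_setOf_isMaximal ha₀0) (fun M hM h => ⟨hM, h ha₀⟩)
    (fun M => if I ≤ M then Q M else M)
    (fun M hM N hN hle => by
      by_cases hIM : I ≤ M
      · rw [if_pos hIM] at hle
        exact (hprop M hM.1).2.2.2.1 N hN hle
      · rw [if_neg hIM] at hle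
        exact hM.1.eq_of_le hN.ne_top hle)
    (fun M => if I ≤ M then b M else 1)
    (fun M hM hIM r hr => by
      rw [if_pos hIM, if_pos hIM] at hr
      exact hclear M hM _ (hprop M hM).2.1 r hr)
  refine ⟨a₀, ha₀, b₀, hb₀, fun y hya hyb i hi => mem_range_of_forall_isIntegralAt fun N hN => ?_⟩
  have hya' := isIntegralAt_of_mem_range hN.ne_top hya
  have hyb' := isIntegralAt_of_mem_range hN.ne_top hyb
  by_cases hIN : I ≤ N
  · have hb := hbQ N ⟨hN, hIN ha₀⟩
    rw [if_pos hIN, if_pos hIN] at hb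
    exact (hprop N hN).2.2.2.2.2 a₀ b₀ (haQ N ⟨hN, hIN⟩) hb y hya' hyb' i hi
  · rw [mul_comm]
    refine IsIntegralAt.algebraMap_mul ?_ i
    by_cases haN : a₀ ∈ N
    · have hb := hbQ N ⟨hN, haN⟩
      rw [if_neg hIN, if_neg hIN] at hb
      refine IsIntegralAt.of_algebraMap_mul (s := b₀) (fun hbN => hN.ne_top ?_)
        (by rwa [mul_comm])
      rw [Ideal.eq_top_iff_one]
      simpa using N.sub_mem hbN hb
    · exact IsIntegralAt.of_algebraMap_mul haN (by rwa [mul_comm])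

end Glue

/-! ### The Mori property -/

section Mori

variable {R K : Type*} [CommRing R] [Field K] [Algebra R K]

theorem mem_fieldColon {S : Set K} {x : K} :
    x ∈ fieldColon R S ↔ ∀ s ∈ S, x * s ∈ Set.range (algebraMap R K) :=
  Iff.rfl

theorem fieldColon_anti {S T : Set K} (h : S ⊆ T) : fieldColon R T ≤ fieldColon R S :=
  fun _ hx s hs => hx s (h hs)

/-- A `2`-`v`-generated domain is a Mori domain. -/
theorem IsTwoVGeneratedDomain.isMoriDomain [IsDomain R] [IsFractionRing R K]
    (h : IsTwoVGeneratedDomain R K) : IsMoriDomain R K := by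
  refine ⟨inferInstance, fun f hf hdiv => ?_⟩
  have hI : (⨆ n, f n) ≠ ⊥ := fun hbot => (hdiv 0).1 (le_bot_iff.1 (hbot ▸ le_iSup f 0))
  obtain ⟨a, ha, b, hb, hab⟩ := h.2 _ hI
  have hmem := fun x => Submodule.mem_iSup_of_directed (x := x) f hf.directed_le
  obtain ⟨m, hm⟩ := (hmem a).1 ha
  obtain ⟨n, hn⟩ := (hmem b).1 hb
  refine ⟨max m n, fun k hk => le_antisymm (fun x hx => ?_) (hf hk)⟩
  have ham : a ∈ f (max m n) := hf (le_max_left _ _) hm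
  have hbn : b ∈ f (max m n) := hf (le_max_right _ _) hn
  -- Since `a` and `b` lie in this term, its colon is contained in `(R : {a, b})`, the colon of the
  -- whole union; so the union lies in its divisorial closure.
  have key : algebraMap R K x ∈ (fieldColon R (fieldColon R
      (imageIn K (f (max m n) : Set R)) : Set K) : Set K) := by
    intro y hy
    have hy1 : y ∈ fieldColon R (imageIn K ({a, b} : Set R)) := by
      refine fieldColon_anti (Set.image_mono ?_) hy
      rintro _ (rfl | rfl)
      exacts [ham, hbn]
    rw [← hab] at hy1
    rw [mul_comm]
    exact hy1 _ ⟨x, (le_iSup f k) hx, rfl⟩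
  rw [← (hdiv (max m n)).2] at key
  obtain ⟨z, hz, hzx⟩ := key
  exact IsFractionRing.injective R K hzx ▸ hz

end Mori

theorem mainTheorem2 (R K : Type*) [CommRing R] [IsDomain R] [Field K] [Algebra R K]
    [IsFractionRing R K] (hdim : ringKrullDim R = 1) (hstable : IsStableDomain R) :
    IsTwoVGeneratedDomain R K ∧ IsMoriDomain R K := by
  have hle : Ring.KrullDimLE 1 R := Ring.krullDimLE_iff.2 hdim.le
  have : Ring.DimensionLEOne R :=
    ⟨fun {p} hp hprime => Ring.krullDimLE_one_iff_of_noZeroDivisors.1 hle p hp hprime⟩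
  -- Dimension exactly one excludes fields.
  have hR : ∀ M : Ideal R, M.IsMaximal → M ≠ ⊥ := by
    rintro M hM rfl
    have hfield : IsField R := Ring.isField_iff_maximal_bot.2 hM
    rw [ringKrullDim_eq_zero_of_isField hfield] at hdim
    exact zero_ne_one hdim
  have htwo : IsTwoVGeneratedDomain R K := by
    refine ⟨inferInstance, fun I hI => ?_⟩
    obtain ⟨a, ha, b, hb, hab⟩ :=
      (hstable.hasStableFractionalIdeals (K := K)).exists_pair_of_dimensionLEOne hR hI
    refine ⟨a, ha, b, hb, le_antisymm (fieldColon_anti (Set.image_mono ?_)) fun y hy => ?_⟩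
    · rintro _ (rfl | rfl)
      exacts [ha, hb]
    · rw [mem_fieldColon] at hy ⊢
      rintro _ ⟨i, hi, rfl⟩
      exact hab y (hy _ ⟨a, by simp, rfl⟩) (hy _ ⟨b, by simp, rfl⟩) i hi
  exact ⟨htwo, htwo.isMoriDomain⟩
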